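/- Fix an integer $m\ge 1$. For every integer $n\ge 1$, let coupons be drawn one after another, independently, each uniformly distributed over $n$ types. Let $T=T_n$ be the number of coupons drawn until each of the $n$ types has appeared at least $m$ times (which happens almost surely in finite time), and for $k\ge m$ let $S_k$ be the number of $k$-tons, i.e. of types that have appeared exactly $k$ times among the first $T$ coupons. Let $k=k(n)$ be integers with $k\ge m$ such that, as $n\to\infty$, $k=o(\log n)$ if $m=1$, and $k=o\left(\frac{\log n}{\log\log n}\right)$ if $m\ge 2$. Then, as $n\to\infty$, the pair $$\left(\frac{T-n\log n-(m-1)n\log\log n}{n},\ \frac{k!\,S_k}{(\log n)^{k-m+1}}\right)$$ converges jointly in distribution to $(X,e^{-X})$, where $X$ has the Gumbel distribution with location $-\log((m-1)!)$ and scale $1$, i.e. $P(X\le x)=e^{-e^{-(x+\log((m-1)!))}}$ for all $x\in\mathbb{R}$. -/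

import Mathlib

open MeasureTheory ProbabilityTheory Filter Asymptotics

/-- `draw 0, draw 1, …` are independent coupons, each uniformly distributed over `n` types. -/
structure IsCouponSequence {Ω : Type*} [MeasurableSpace Ω] (P : Measure Ω) {n : ℕ}
    (draw : ℕ → Ω → Fin n) : Prop where
  measurable : ∀ i, Measurable (draw i)
  indep : iIndepFun draw P
  uniform : ∀ i c, P.real {ω | draw i ω = c} = 1 / (n : ℝ)

/-- The number of copies of the type `c` among the first `t` coupons of the sequence `x`. -/
def copies {n : ℕ} (x : ℕ → Fin n) (t : ℕ) (c : Fin n) : ℕ :=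
  ((Finset.range t).filter fun i => x i = c).card

/-- The number `T` of coupons drawn until every type has been seen at least `m` times.
(For random uniform coupons such a time exists almost surely; the value is `0` otherwise.) -/
noncomputable def collectionTime {n : ℕ} (m : ℕ) (x : ℕ → Fin n) : ℕ :=
  sInf {t | ∀ c, m ≤ copies x t c}

/-- The number `S_k` of `k`-tons: types seen exactly `k` times among the first `T` coupons. -/
noncomputable def numTons {n : ℕ} (m k : ℕ) (x : ℕ → Fin n) : ℕ :=
  (Finset.univ.filter fun c => copies x (collectionTime m x) c = k).card

/-- `X` has the Gumbel distribution with location `μ` and scale `β`, given by its distribution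
function. -/
def IsGumbel {Ω : Type*} [MeasurableSpace Ω] (P : Measure Ω) (X : Ω → ℝ) (μ β : ℝ) : Prop :=
  AEMeasurable X P ∧
    ∀ x : ℝ, P.real {ω | X ω ≤ x} = Real.exp (-Real.exp (-((x - μ) / β)))

open scoped Topology

/-! Write m = d + 1 and t_x = n log n + d n log log n + x n. At time t_x the number of types with at
most d copies is asymptotically Poisson with mean e^{-x}/d!: its r-th binomial moment tends to
(e^{-x}/d!)^r / r!, and a bound C^r / r! uniform in r lets the limit pass through
inclusion-exclusion. No such type is left exactly when T ≤ t_x, so P(T ≤ t_x) tends to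
exp(-e^{-x}/d!), the required Gumbel distribution function (`tendsto_measureReal_forall_le_copies`).

At the same fixed time the k-tons are numerous: their expected number is about e^{-x} (log n)^{k-d}
/ k!, which tends to infinity, and the joint probability for two types is at most 1 + o(1) times the
product. By Chebyshev the scaled count tends to the constant e^{-x}
(`tendsto_measureReal_tons_sub`). The growth condition on k is what allows t_x^k to be replaced by
(n log n)^k. Types with fewer than k copies are of smaller order, since consecutive binomial
probabilities below k have ratio O(k / log n) (`tendsto_measureReal_lt_tons`).

To pass to the random time T, a fine finite grid of values x is used. The number of k-tons at T is
trapped between the numbers at the neighbouring grid times, up to types with fewer than k copies at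
the earlier one. Hence the scaled S_k differs from exp(-Y), with Y the centred T, by a quantity
tending to 0 in probability (`tendsto_measureReal_numTons_sub`), and a Slutsky argument gives the
joint limit. -/

lemma copies_succ {n : ℕ} (x : ℕ → Fin n) (t : ℕ) (c : Fin n) :
    copies x (t + 1) c = copies x t c + if x t = c then 1 else 0 := by
  unfold copies
  rw [Finset.range_add_one, Finset.filter_insert]
  split_ifs with h
  · rw [Finset.card_insert_of_notMem (by simp)]
  · simp

lemma copies_mono {n : ℕ} (x : ℕ → Fin n) (c : Fin n) : Monotone fun t => copies x t c :=
  monotone_nat_of_le_succ fun t => by rw [copies_succ]; omega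

/-! ### Measurability and multinomial law of the copy counts -/

namespace IsCouponSequence

variable {Ω : Type*} [MeasurableSpace Ω] {P : Measure Ω} {n : ℕ} {draw : ℕ → Ω → Fin n}

lemma measurable_copies (h : IsCouponSequence P draw) (t : ℕ) :
    Measurable fun ω => copies (fun i => draw i ω) t := by
  induction t with
  | zero =>
    have : (fun ω => copies (fun i => draw i ω) 0) = fun _ => 0 := by
      funext ω c; simp [copies]
    rw [this]; exact measurable_const
  | succ t ih =>
    refine measurable_pi_iff.2 fun c => ?_
    simp only [copies_succ]
    refine ((measurable_pi_apply c).comp ih).add (Measurable.ite ?_ measurable_const measurable_const)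
    exact h.measurable t (measurableSet_singleton c)

lemma measurableSet_copies (h : IsCouponSequence P draw) (t : ℕ) (A : Set (Fin n → ℕ)) :
    MeasurableSet {ω | copies (fun i => draw i ω) t ∈ A} :=
  h.measurable_copies t (A.to_countable.measurableSet)

lemma measurableSet_copies' (h : IsCouponSequence P draw) (t : ℕ) (A : (Fin n → ℕ) → Prop) :
    MeasurableSet {ω | A (copies (fun i => draw i ω) t)} :=
  h.measurableSet_copies t {v | A v}

/-- The counts at time `t` are a function of the draws with index below `t`, an index set disjoint
from `{t}`. -/
lemma indepFun_copies (h : IsCouponSequence P draw) (t : ℕ) :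
    IndepFun (fun ω => copies (fun i => draw i ω) t) (draw t) P := by
  have h1 := h.indep.indepFun_finset (Finset.range t) {t} (by simp) h.measurable
  let φ : (Finset.range t → Fin n) → Fin n → ℕ := fun y c =>
    (Finset.univ.filter fun i => y i = c).card
  let ψ : (({t} : Finset ℕ) → Fin n) → Fin n := fun y => y ⟨t, by simp⟩
  have h2 := h1.comp (φ := φ) (ψ := ψ) (measurable_of_countable _) (measurable_of_countable _)
  convert! h2 using 1
  funext ω c
  simp only [φ, copies, Function.comp]
  rw [← Finset.card_subtype, ← Finset.card_map (Function.Embedding.subtype _)]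
  rw [← Finset.card_map (Function.Embedding.subtype _)]
  congr 1
  ext i
  simp
  tauto

/-- The one-step recursion for the law of the copy counts. -/
lemma measureReal_copies_succ (h : IsCouponSequence P draw) (t : ℕ) (A : Set (Fin n → ℕ)) :
    P.real {ω | copies (fun i => draw i ω) (t + 1) ∈ A} =
      ∑ d, (1 / (n : ℝ)) * P.real {ω | copies (fun i => draw i ω) t + Pi.single d 1 ∈ A} := by
  have := h.indep.isProbabilityMeasure
  have hset : {ω | copies (fun i => draw i ω) (t + 1) ∈ A} =
      ⋃ d ∈ (Finset.univ : Finset (Fin n)),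
        ({ω | copies (fun i => draw i ω) t + Pi.single d 1 ∈ A} ∩ {ω | draw t ω = d}) := by
    ext ω
    have h1 : copies (fun i => draw i ω) (t + 1) =
        copies (fun i => draw i ω) t + Pi.single (draw t ω) 1 := by
      funext c
      rw [copies_succ]
      simp only [Pi.add_apply, Pi.single_apply, eq_comm]
    simp [h1]
  have hm : ∀ d, MeasurableSet {ω | draw t ω = d} := fun d =>
    h.measurable t (measurableSet_singleton d)
  rw [hset, measureReal_biUnion_finset]
  · refine Finset.sum_congr rfl fun d _ => ?_
    rw [mul_comm, ← h.uniform t d]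
    have := (h.indepFun_copies t).measure_inter_preimage_eq_mul
      {v | v + Pi.single d 1 ∈ A} {d} (Set.to_countable _).measurableSet (measurableSet_singleton d)
    simp only [Measure.real, ← ENNReal.toReal_mul]
    exact congrArg _ this
  · intro d _ d' _ hd
    refine Set.disjoint_left.2 fun ω h1 h2 => hd ?_
    exact h1.2.symm.trans h2.2
  · exact fun d _ => (h.measurableSet_copies' t fun v => v + Pi.single d 1 ∈ A).inter (hm d)

end IsCouponSequence

/-- This is the recursion in `t` behind the multinomial law, with `z = n - |s|`: the first term
accounts for a draw outside `s`, the second for a draw inside. For `J = 0` the truncated `J - 1` is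
harmless because of the factor `J`. -/
lemma descFactorial_step (t J : ℕ) (z : ℝ) :
    z * (t.descFactorial J * z ^ (t - J)) + J * (t.descFactorial (J - 1) * z ^ (t - (J - 1))) =
      (t + 1).descFactorial J * z ^ (t + 1 - J) := by
  rcases J with _ | i
  · simp [pow_succ']
  · rcases lt_trichotomy i t with h | h | h
    · obtain ⟨u, rfl⟩ : ∃ u, t = i + 1 + u := ⟨t - i - 1, by omega⟩
      rw [Nat.succ_descFactorial_succ, Nat.descFactorial_succ]
      have e1 : i + 1 + u - i = u + 1 := by omega
      have e2 : i + 1 + u - (i + 1) = u := by omega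
      have e3 : i + 1 + u + 1 - (i + 1) = u + 1 := by omega
      have e4 : i + 1 - 1 = i := rfl
      rw [e4, e1, e2, e3]
      push_cast
      ring
    · subst h
      rw [Nat.succ_descFactorial_succ, Nat.descFactorial_of_lt (Nat.lt_succ_self i)]
      simp
    · rw [Nat.descFactorial_of_lt (by omega : t < i + 1), Nat.descFactorial_of_lt (by omega : t < i + 1 - 1),
        Nat.descFactorial_of_lt (by omega : t + 1 < i + 1)]
      simp

namespace IsCouponSequence

variable {Ω : Type*} [MeasurableSpace Ω] {P : Measure Ω} {n : ℕ} {draw : ℕ → Ω → Fin n}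

/-- The multinomial law of the copy counts of the types in `s`. -/
lemma measureReal_copies_eq (h : IsCouponSequence P draw) (s : Finset (Fin n)) (t : ℕ)
    (j : Fin n → ℕ) :
    P.real {ω | ∀ c ∈ s, copies (fun i => draw i ω) t c = j c} *
        ((n : ℝ) ^ t * ∏ c ∈ s, ((j c).factorial : ℝ)) =
      t.descFactorial (∑ c ∈ s, j c) * ((n : ℝ) - s.card) ^ (t - ∑ c ∈ s, j c) := by
  have := h.indep.isProbabilityMeasure
  -- A draw of `d ∈ s` lowers the target `j d` by one, so `j` must vary. With denominators cleared
  -- the identity also holds when `∑ j > t`, where the falling factorial vanishes.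
  induction t generalizing j with
  | zero =>
    by_cases hj : ∀ c ∈ s, j c = 0
    · have h1 : {ω | ∀ c ∈ s, copies (fun i => draw i ω) 0 c = j c} = Set.univ := by
        ext ω; simpa [copies, eq_comm] using hj
      rw [h1, Finset.sum_eq_zero hj, Finset.prod_congr rfl fun c hc => by rw [hj c hc]]
      simp
    · have h1 : {ω | ∀ c ∈ s, copies (fun i => draw i ω) 0 c = j c} = ∅ := by
        ext ω; simpa [copies, eq_comm] using hj
      have h2 : 0 < ∑ c ∈ s, j c := by
        rw [pos_iff_ne_zero, Ne, Finset.sum_eq_zero_iff]; exact hj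
      rw [h1, Nat.descFactorial_of_lt h2]
      simp
  | succ t ih =>
    -- With no types `draw 0` has no value, so `Ω` is empty, which contradicts total mass one.
    by_cases hn : n = 0
    · subst hn
      have hΩ : IsEmpty Ω := ⟨fun ω => (draw 0 ω).elim0⟩
      have := measure_univ (μ := P)
      simp [Set.eq_empty_of_isEmpty] at this
    have hn' : (n : ℝ) ≠ 0 := by exact_mod_cast hn
    set J := ∑ c ∈ s, j c with hJ
    set F := ∏ c ∈ s, ((j c).factorial : ℝ) with hF
    set z : ℝ := (n : ℝ) - s.card with hz
    have key : ∀ d, P.real {ω | ∀ c ∈ s, copies (fun i => draw i ω) t c + (Pi.single d 1 : Fin n → ℕ) c = j c} *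
        ((n : ℝ) ^ t * F) = if d ∈ s then j d * (t.descFactorial (J - 1) * z ^ (t - (J - 1)))
          else t.descFactorial J * z ^ (t - J) := by
      intro d
      split_ifs with hd
      · rcases Nat.eq_zero_or_pos (j d) with h0 | h0
        · have : {ω | ∀ c ∈ s, copies (fun i => draw i ω) t c + (Pi.single d 1 : Fin n → ℕ) c = j c} = ∅ := by
            ext ω
            simp only [Set.mem_ofPred_eq, Set.mem_empty_iff_false, iff_false, not_forall]
            exact ⟨d, hd, by simp [h0]⟩
          rw [this, h0]; simp
        · have e1 : {ω | ∀ c ∈ s, copies (fun i => draw i ω) t c + (Pi.single d 1 : Fin n → ℕ) c = j c} =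
              {ω | ∀ c ∈ s, copies (fun i => draw i ω) t c = Function.update j d (j d - 1) c} := by
            ext ω
            simp only [Set.mem_ofPred_eq]
            refine forall₂_congr fun c _ => ?_
            by_cases hc : c = d
            · subst hc; simp; omega
            · simp [hc]
          have e2 : ∑ c ∈ s, Function.update j d (j d - 1) c = J - 1 := by
            rw [Finset.sum_update_of_mem hd, hJ, Finset.sdiff_singleton_eq_erase,
              ← Finset.add_sum_erase s j hd]
            omega
          have e3 : F = j d * ∏ c ∈ s, ((Function.update j d (j d - 1) c).factorial : ℝ) := by
            rw [hF, ← Finset.mul_prod_erase s _ hd, ← Finset.mul_prod_erase s _ hd,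
              Function.update_self, ← mul_assoc, ← Nat.mul_factorial_pred h0.ne']
            push_cast
            congr 1
            refine Finset.prod_congr rfl fun c hc => ?_
            rw [Function.update_of_ne (Finset.ne_of_mem_erase hc)]
          have := ih (Function.update j d (j d - 1))
          rw [e2] at this
          rw [e1, e3, ← this]
          ring
      · have e1 : {ω | ∀ c ∈ s, copies (fun i => draw i ω) t c + (Pi.single d 1 : Fin n → ℕ) c = j c} =
              {ω | ∀ c ∈ s, copies (fun i => draw i ω) t c = j c} := by
          ext ω
          simp only [Set.mem_ofPred_eq]
          refine forall₂_congr fun c hc => ?_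
          have : c ≠ d := fun h => hd (h ▸ hc)
          simp [this]
        rw [e1, ih j]
    have hs := h.measureReal_copies_succ t {v | ∀ c ∈ s, v c = j c}
    simp only [Set.mem_ofPred_eq, Pi.add_apply] at hs
    rw [hs, ← descFactorial_step, Finset.sum_mul]
    have : ∀ d, 1 / (n : ℝ) * P.real
        {ω | ∀ c ∈ s, copies (fun i => draw i ω) t c + (Pi.single d 1 : Fin n → ℕ) c = j c} *
        ((n : ℝ) ^ (t + 1) * F) = if d ∈ s then j d * (t.descFactorial (J - 1) * z ^ (t - (J - 1)))
          else t.descFactorial J * z ^ (t - J) := by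
      intro d
      rw [← key d]
      field_simp
      ring
    rw [Finset.sum_congr rfl fun d _ => this d, Finset.sum_ite, Finset.filter_mem_eq_inter,
      Finset.univ_inter, ← Finset.sum_mul, Finset.sum_const, nsmul_eq_mul, add_comm]
    congr 1
    · rw [hz, Finset.filter_not, Finset.filter_mem_eq_inter, Finset.univ_inter,
        ← Finset.compl_eq_univ_sdiff, Finset.card_compl, Fintype.card_fin,
        Nat.cast_sub (by simpa using s.card_le_univ)]
    · rw [hJ]; push_cast; ring

end IsCouponSequence

/-! ### Joint probabilities of few copies, and inclusion-exclusion -/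

lemma sum_piFinset_prod_ite {ι : Type*} [Fintype ι] [DecidableEq ι] (s : Finset ι) (m : ℕ)
    (g : ℕ → ℝ) :
    ∑ j ∈ Fintype.piFinset fun c => if c ∈ s then Finset.range m else {0}, ∏ c ∈ s, g (j c) =
      (∑ i ∈ Finset.range m, g i) ^ s.card := by
  have h1 : ∀ j : ι → ℕ, ∏ c ∈ s, g (j c) = ∏ c, if c ∈ s then g (j c) else 1 := by
    intro j
    rw [Finset.prod_ite_mem, Finset.univ_inter]
  simp_rw [h1]
  -- Functions are pinned to `0` off `s`, so each assignment on `s` occurs once and the factors off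
  -- `s` are `1`.
  rw [← Finset.prod_univ_sum (fun c => if c ∈ s then Finset.range m else {0})
    (fun c i => if c ∈ s then g i else 1)]
  have h2 : ∀ c, (∑ i ∈ (if c ∈ s then Finset.range m else {0}), if c ∈ s then g i else 1) =
      if c ∈ s then ∑ i ∈ Finset.range m, g i else 1 := by
    intro c
    split_ifs <;> simp
  simp_rw [h2]
  rw [Finset.prod_ite_mem, Finset.univ_inter, Finset.prod_const]

namespace IsCouponSequence

variable {Ω : Type*} [MeasurableSpace Ω] {P : Measure Ω} {n : ℕ} {draw : ℕ → Ω → Fin n}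

lemma measureReal_copies_lt_eq_sum (h : IsCouponSequence P draw) (s : Finset (Fin n)) (t m : ℕ) :
    P.real {ω | ∀ c ∈ s, copies (fun i => draw i ω) t c < m} =
      ∑ j ∈ Fintype.piFinset fun c => if c ∈ s then Finset.range m else {0},
        P.real {ω | ∀ c ∈ s, copies (fun i => draw i ω) t c = j c} := by
  have := h.indep.isProbabilityMeasure
  have hset : {ω | ∀ c ∈ s, copies (fun i => draw i ω) t c < m} =
      ⋃ j ∈ Fintype.piFinset fun c => if c ∈ s then Finset.range m else {0},
        {ω | ∀ c ∈ s, copies (fun i => draw i ω) t c = j c} := by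
    ext ω
    simp only [Set.mem_ofPred_eq, Set.mem_iUnion, Fintype.mem_piFinset, exists_prop]
    constructor
    · intro hω
      refine ⟨fun c => if c ∈ s then copies (fun i => draw i ω) t c else 0, fun c => ?_,
        fun c hc => by simp [hc]⟩
      by_cases hc : c ∈ s
      · simpa [hc] using hω c hc
      · simp [hc]
    · rintro ⟨j, hj, hω⟩ c hc
      have := hj c
      rw [hω c hc]
      simpa [hc] using this
  rw [hset, measureReal_biUnion_finset]
  · intro j hj j' hj' hne
    refine Set.disjoint_left.2 fun ω h1 h2 => hne ?_
    funext c
    by_cases hc : c ∈ s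
    · exact (h1 c hc).symm.trans (h2 c hc)
    · have e1 := Fintype.mem_piFinset.1 hj c
      have e2 := Fintype.mem_piFinset.1 hj' c
      simp only [hc, if_false, Finset.mem_singleton] at e1 e2
      rw [e1, e2]
  · exact fun j _ => h.measurableSet_copies' t fun v => ∀ c ∈ s, v c = j c

lemma sum_le_of_mem_piFinset {s : Finset (Fin n)} {m : ℕ} {j : Fin n → ℕ}
    (hj : j ∈ Fintype.piFinset fun c => if c ∈ s then Finset.range m else {0}) :
    ∑ c ∈ s, j c ≤ s.card * (m - 1) := by
  rw [← smul_eq_mul]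
  refine Finset.sum_le_card_nsmul _ _ _ fun c hc => ?_
  have := Fintype.mem_piFinset.1 hj c
  simp only [hc, if_true, Finset.mem_range] at this
  omega

lemma measureReal_copies_eq_div (h : IsCouponSequence P draw) (hn : n ≠ 0) (s : Finset (Fin n))
    {t : ℕ} {j : Fin n → ℕ} (hJ : ∑ c ∈ s, j c ≤ t) :
    P.real {ω | ∀ c ∈ s, copies (fun i => draw i ω) t c = j c} =
      t.descFactorial (∑ c ∈ s, j c) / (n : ℝ) ^ (∑ c ∈ s, j c) / (∏ c ∈ s, ((j c).factorial : ℝ)) *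
        (1 - s.card / (n : ℝ)) ^ (t - ∑ c ∈ s, j c) := by
  have hn' : (n : ℝ) ≠ 0 := by exact_mod_cast hn
  have hF : ∏ c ∈ s, ((j c).factorial : ℝ) ≠ 0 :=
    Finset.prod_ne_zero_iff.2 fun c _ => by exact_mod_cast (j c).factorial_ne_zero
  have h1 := h.measureReal_copies_eq s t j
  have h2 : (1 - s.card / (n : ℝ)) = ((n : ℝ) - s.card) / n := by field_simp
  have h3 : (n : ℝ) ^ t = n ^ (∑ c ∈ s, j c) * n ^ (t - ∑ c ∈ s, j c) := by
    rw [← pow_add, Nat.add_sub_cancel' hJ]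
  rw [h2, div_pow]
  rw [h3] at h1
  field_simp
  rw [← h1]
  ring

lemma one_sub_card_div_nonneg (s : Finset (Fin n)) : 0 ≤ 1 - s.card / (n : ℝ) := by
  have : (s.card : ℝ) ≤ n := by exact_mod_cast (by simpa using s.card_le_univ)
  have := div_le_one_of_le₀ this (Nat.cast_nonneg n)
  linarith

/-- Bounding the falling factorial by a power and the exponent `t - ∑ j` below by `t - |s|(m-1)`
makes the sum over `j` factorise over `s`. -/
lemma measureReal_copies_lt_le (h : IsCouponSequence P draw) (hn : n ≠ 0) (s : Finset (Fin n))
    {t m : ℕ} (ht : s.card * (m - 1) ≤ t) :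
    P.real {ω | ∀ c ∈ s, copies (fun i => draw i ω) t c < m} ≤
      (∑ i ∈ Finset.range m, ((t : ℝ) / n) ^ i / i.factorial) ^ s.card *
        (1 - s.card / (n : ℝ)) ^ (t - s.card * (m - 1)) := by
  rw [h.measureReal_copies_lt_eq_sum, ← sum_piFinset_prod_ite, Finset.sum_mul]
  refine Finset.sum_le_sum fun j hj => ?_
  have hJ := sum_le_of_mem_piFinset hj
  rw [h.measureReal_copies_eq_div hn s (hJ.trans ht), Finset.prod_div_distrib, Finset.prod_pow_eq_pow_sum,
    div_pow]
  gcongr ?_ / _ / _ * ?_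
  · exact pow_nonneg (one_sub_card_div_nonneg s) _
  · exact_mod_cast Nat.descFactorial_le_pow _ _
  · refine pow_le_pow_of_le_one (one_sub_card_div_nonneg s) ?_ (by omega)
    have : (0 : ℝ) ≤ s.card / n := by positivity
    linarith

/-- The reverse estimate: each factor of the falling factorial is at least `t - |s|(m-1)`, and
raising the exponent to `t` only decreases a power of a number in `[0, 1]`. -/
lemma le_measureReal_copies_lt (h : IsCouponSequence P draw) (hn : n ≠ 0) (s : Finset (Fin n))
    {t m : ℕ} (ht : s.card * (m - 1) ≤ t) :
    (∑ i ∈ Finset.range m, ((t - s.card * (m - 1) : ℕ) / (n : ℝ)) ^ i / i.factorial) ^ s.card *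
        (1 - s.card / (n : ℝ)) ^ t ≤
      P.real {ω | ∀ c ∈ s, copies (fun i => draw i ω) t c < m} := by
  rw [h.measureReal_copies_lt_eq_sum, ← sum_piFinset_prod_ite, Finset.sum_mul]
  refine Finset.sum_le_sum fun j hj => ?_
  have hJ := sum_le_of_mem_piFinset hj
  rw [h.measureReal_copies_eq_div hn s (hJ.trans ht), Finset.prod_div_distrib, Finset.prod_pow_eq_pow_sum,
    div_pow]
  gcongr ?_ / _ / _ * ?_
  · exact pow_nonneg (one_sub_card_div_nonneg s) _
  · refine le_trans ?_ (by exact_mod_cast Nat.pow_sub_le_descFactorial t (∑ c ∈ s, j c) :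
      (((t + 1 - ∑ c ∈ s, j c : ℕ) : ℝ) ^ (∑ c ∈ s, j c) ≤ _))
    gcongr
    omega
  · refine pow_le_pow_of_le_one (one_sub_card_div_nonneg s) ?_ (by omega)
    have : (0 : ℝ) ≤ s.card / n := by positivity
    linarith

/-- Inclusion-exclusion for the event that no type has fewer than `m` copies. -/
lemma measureReal_forall_le_copies (h : IsCouponSequence P draw) (t m : ℕ) :
    P.real {ω | ∀ c, m ≤ copies (fun i => draw i ω) t c} =
      ∑ r ∈ Finset.range (n + 1), (-1 : ℝ) ^ r *
        ∑ s ∈ Finset.powersetCard r Finset.univ,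
          P.real {ω | ∀ c ∈ s, copies (fun i => draw i ω) t c < m} := by
  classical
  have := h.indep.isProbabilityMeasure
  have hm : ∀ c, MeasurableSet {ω | copies (fun i => draw i ω) t c < m} := fun c =>
    h.measurableSet_copies' t fun v => v c < m
  have hU : MeasurableSet (⋃ c ∈ (Finset.univ : Finset (Fin n)),
      {ω | copies (fun i => draw i ω) t c < m}) :=
    Finset.measurableSet_biUnion _ fun c _ => hm c
  have hset : {ω | ∀ c, m ≤ copies (fun i => draw i ω) t c} =
      (⋃ c ∈ (Finset.univ : Finset (Fin n)), {ω | copies (fun i => draw i ω) t c < m})ᶜ := by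
    ext ω; simp
  have hI : ∀ s : Finset (Fin n), ⋂ c ∈ s, {ω | copies (fun i => draw i ω) t c < m} =
      {ω | ∀ c ∈ s, copies (fun i => draw i ω) t c < m} := by
    intro s; ext ω; simp
  rw [hset, probReal_compl_eq_one_sub hU,
    measureReal_biUnion_eq_sum_powerset (fun c _ => hm c)]
  simp_rw [hI]
  have hsplit : ∑ s ∈ (Finset.univ : Finset (Fin n)).powerset, (-1 : ℝ) ^ s.card *
      P.real {ω | ∀ c ∈ s, copies (fun i => draw i ω) t c < m} =
      ∑ r ∈ Finset.range (n + 1), (-1 : ℝ) ^ r *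
        ∑ s ∈ Finset.powersetCard r Finset.univ,
          P.real {ω | ∀ c ∈ s, copies (fun i => draw i ω) t c < m} := by
    rw [Finset.sum_powerset, Finset.card_univ, Fintype.card_fin]
    refine Finset.sum_congr rfl fun r _ => ?_
    rw [Finset.mul_sum]
    refine Finset.sum_congr rfl fun s hs => ?_
    rw [(Finset.mem_powersetCard.1 hs).2]
  rw [← hsplit, ← Finset.sum_filter_add_sum_filter_not _ (fun s : Finset (Fin n) => s.Nonempty)
    (fun s => (-1 : ℝ) ^ s.card * P.real {ω | ∀ c ∈ s, copies (fun i => draw i ω) t c < m})]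
  have : (Finset.univ : Finset (Fin n)).powerset.filter (fun s => ¬ s.Nonempty) = {∅} := by
    ext s; simp [Finset.not_nonempty_iff_eq_empty]
  rw [this]
  simp only [Finset.sum_singleton, Finset.card_empty, pow_zero, one_mul, Finset.notMem_empty,
    false_imp_iff, implies_true]
  have hu : P.real {_ω : Ω | True} = 1 := by simp
  rw [hu, sub_eq_add_neg, add_comm, ← Finset.sum_neg_distrib]
  congr 1
  refine Finset.sum_congr rfl fun s _ => ?_
  rw [pow_succ]; ring

end IsCouponSequence

/-! ### Asymptotics on the collection time scale -/

lemma tendsto_pnat_cast_atTop : Tendsto (fun n : ℕ+ => (n : ℝ)) atTop atTop :=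
  tendsto_natCast_atTop_atTop.comp tendsto_PNat_val_atTop_atTop

lemma tendsto_log_pnat : Tendsto (fun n : ℕ+ => Real.log n) atTop atTop :=
  Real.tendsto_log_atTop.comp tendsto_pnat_cast_atTop

lemma tendsto_log_div_pnat : Tendsto (fun n : ℕ+ => Real.log n / n) atTop (𝓝 0) :=
  Real.isLittleO_log_id_atTop.tendsto_div_nhds_zero.comp tendsto_pnat_cast_atTop

lemma tendsto_loglog_div_log_pnat :
    Tendsto (fun n : ℕ+ => Real.log (Real.log n) / Real.log n) atTop (𝓝 0) :=
  Real.isLittleO_log_id_atTop.tendsto_div_nhds_zero.comp tendsto_log_pnat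

lemma tendsto_const_div_pnat (a : ℝ) : Tendsto (fun n : ℕ+ => a / (n : ℝ)) atTop (𝓝 0) :=
  tendsto_const_nhds.div_atTop tendsto_pnat_cast_atTop

lemma tendsto_exp_one_of_tendsto_zero {ι : Type*} {l : Filter ι} {f : ι → ℝ}
    (hf : Tendsto f l (𝓝 0)) : Tendsto (fun i => Real.exp (f i)) l (𝓝 1) := by
  have := (Real.continuous_exp.tendsto 0).comp hf
  rwa [Real.exp_zero] at this

/-- If `u → 0` and `t u² → 0` then `(1 - u) ^ t ~ exp (- t u)`. -/
lemma tendsto_one_sub_pow_mul_exp {ι : Type*} {l : Filter ι} {u : ι → ℝ} {t : ι → ℕ}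
    (hu : Tendsto u l (𝓝 0)) (htu : Tendsto (fun i => t i * u i ^ 2) l (𝓝 0)) :
    Tendsto (fun i => (1 - u i) ^ t i * Real.exp (t i * u i)) l (𝓝 1) := by
  have hsmall : ∀ᶠ i in l, |u i| < 1 / 2 := by
    have := hu.abs
    rw [abs_zero] at this
    exact this.eventually_lt_const (by norm_num)
  have hexp : Tendsto (fun i => Real.exp (t i * (u i + Real.log (1 - u i)))) l (𝓝 1) := by
    refine tendsto_exp_one_of_tendsto_zero ?_
    have h2 : Tendsto (fun i => 2 * (t i * u i ^ 2)) l (𝓝 0) := by simpa using htu.const_mul 2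
    refine squeeze_zero_norm' ?_ h2
    filter_upwards [hsmall] with i hi
    -- First-order Taylor remainder: `|u + log (1 - u)| ≤ u² / (1 - |u|)`, at most `2 u²` for `|u| <
    -- 1/2`.
    have h1 := Real.abs_log_sub_add_sum_range_le (x := u i) (by linarith) 1
    simp only [Finset.sum_range_one, Nat.cast_zero, zero_add, pow_one, div_one] at h1
    rw [Real.norm_eq_abs, abs_mul, Nat.abs_cast]
    have h3 : |u i| ^ (1 + 1) / (1 - |u i|) ≤ 2 * u i ^ 2 := by
      rw [div_le_iff₀ (by linarith), ← sq_abs (u i), one_add_one_eq_two]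
      have : 0 ≤ |u i| ^ 2 := by positivity
      nlinarith [mul_nonneg this (by linarith : (0 : ℝ) ≤ 1 / 2 - |u i|)]
    calc (t i : ℝ) * |u i + Real.log (1 - u i)| ≤ t i * (2 * u i ^ 2) := by
          gcongr; exact h1.trans h3
      _ = _ := by ring
  refine hexp.congr' ?_
  filter_upwards [hsmall] with i hi
  have hpos : 0 < 1 - u i := by linarith [(abs_lt.1 hi).2]
  rw [mul_add, Real.exp_add, ← Real.log_pow, Real.exp_log (pow_pos hpos _), mul_comm]

/-- If `e → 0` and `k e → 0` then `(1 + e) ^ k → 1`. -/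
lemma tendsto_one_add_pow_one {ι : Type*} {l : Filter ι} {e : ι → ℝ} {k : ι → ℕ}
    (he : Tendsto e l (𝓝 0)) (hke : Tendsto (fun i => k i * e i) l (𝓝 0)) :
    Tendsto (fun i => (1 + e i) ^ k i) l (𝓝 1) := by
  have h1 := tendsto_one_sub_pow_mul_exp (u := fun i => - e i) (t := k) (by simpa using he.neg)
    (by simpa [sq, mul_assoc] using hke.mul he)
  have h2 : Tendsto (fun i => Real.exp (k i * e i)) l (𝓝 1) :=
    tendsto_exp_one_of_tendsto_zero hke
  have h3 := h1.mul h2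
  rw [one_mul] at h3
  refine h3.congr fun i => ?_
  rw [mul_assoc, ← Real.exp_add]
  simp

/-- The times `t n` are of the form `n log n + d n log (log n) + x n + o(n)`. -/
def IsCollectionScale (d : ℕ) (t : ℕ+ → ℕ) (x : ℝ) : Prop :=
  Tendsto (fun n : ℕ+ => (t n : ℝ) / n - Real.log n - d * Real.log (Real.log n)) atTop (𝓝 x)

namespace IsCollectionScale

variable {d : ℕ} {t : ℕ+ → ℕ} {x : ℝ}

/-- On this scale `t / (n log n) - 1 = (d log log n + x + o(1)) / log n`. The weight `g` is later
`1`, or `k`, where the growth conditions on the multiplicities enter. -/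
lemma tendsto_div_mul_log_sub_one_mul {g : ℕ+ → ℝ} (h : IsCollectionScale d t x)
    (hg1 : Tendsto (fun n : ℕ+ => g n * (d * Real.log (Real.log n)) / Real.log n) atTop (𝓝 0))
    (hg2 : Tendsto (fun n : ℕ+ => g n / Real.log n) atTop (𝓝 0)) :
    Tendsto (fun n : ℕ+ => g n * ((t n : ℝ) / (n * Real.log n) - 1)) atTop (𝓝 0) := by
  have h1 := hg1.add (hg2.mul h)
  rw [zero_mul, zero_add] at h1
  refine h1.congr' ?_
  filter_upwards [tendsto_log_pnat.eventually_gt_atTop 0] with n hn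
  have : (n : ℝ) ≠ 0 := by positivity
  field_simp
  ring

lemma tendsto_div_mul_log (h : IsCollectionScale d t x) :
    Tendsto (fun n : ℕ+ => (t n : ℝ) / (n * Real.log n)) atTop (𝓝 1) := by
  have := h.tendsto_div_mul_log_sub_one_mul (g := fun _ => 1)
    (by simpa [mul_div_assoc] using tendsto_loglog_div_log_pnat.const_mul (d : ℝ))
    (tendsto_const_nhds.div_atTop tendsto_log_pnat)
  simpa using this.add_const 1

lemma tendsto_div_atTop (h : IsCollectionScale d t x) :
    Tendsto (fun n : ℕ+ => (t n : ℝ) / n) atTop atTop := by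
  have := h.tendsto_div_mul_log.pos_mul_atTop one_pos tendsto_log_pnat
  refine this.congr' ?_
  filter_upwards [tendsto_log_pnat.eventually_gt_atTop 0] with n hn
  field_simp

lemma tendsto_div_sq (h : IsCollectionScale d t x) :
    Tendsto (fun n : ℕ+ => (t n : ℝ) / (n : ℝ) ^ 2) atTop (𝓝 0) := by
  have := h.tendsto_div_mul_log.mul tendsto_log_div_pnat
  rw [mul_zero] at this
  refine this.congr' ?_
  filter_upwards [tendsto_log_pnat.eventually_gt_atTop 0] with n hn
  field_simp

lemma congr {t' : ℕ+ → ℕ} (h : IsCollectionScale d t x) (y : ℝ)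
    (ht : Tendsto (fun n : ℕ+ => (t' n : ℝ) / n - (t n : ℝ) / n) atTop (𝓝 y)) :
    IsCollectionScale d t' (x + y) := by
  refine (Tendsto.add h ht).congr fun n => ?_
  ring

lemma eventually_mul_le (h : IsCollectionScale d t x) (b : ℕ) : ∀ᶠ n : ℕ+ in atTop, n * b ≤ t n := by
  filter_upwards [h.tendsto_div_atTop.eventually_ge_atTop (b : ℝ)] with n hn
  rw [le_div_iff₀ (by positivity)] at hn
  rw [mul_comm]
  exact_mod_cast hn

lemma eventually_le (h : IsCollectionScale d t x) (b : ℕ) : ∀ᶠ n : ℕ+ in atTop, b ≤ t n := by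
  filter_upwards [h.eventually_mul_le b] with n hn
  exact (Nat.le_mul_of_pos_left b n.pos).trans hn

lemma sub_const (h : IsCollectionScale d t x) (b : ℕ) : IsCollectionScale d (fun n => t n - b) x := by
  rw [← add_zero x]
  refine h.congr 0 ?_
  have := (tendsto_const_div_pnat (b : ℝ)).neg
  rw [neg_zero] at this
  refine this.congr' ?_
  filter_upwards [h.eventually_le b] with n hn
  rw [Nat.cast_sub hn]
  ring

/-- A shift by a multiple of `n` stays on the scale; it gives room for an exponent bound uniform in
`r ≤ n`. -/
lemma sub_mul (h : IsCollectionScale d t x) (b : ℕ) :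
    IsCollectionScale d (fun n => t n - n * b) (x - b) := by
  rw [sub_eq_add_neg]
  refine h.congr _ (tendsto_const_nhds.congr' ?_)
  filter_upwards [h.eventually_mul_le b] with n hn
  have : (n : ℝ) ≠ 0 := by positivity
  rw [Nat.cast_sub hn]
  push_cast
  field_simp
  ring

lemma tendsto_mul_exp (h : IsCollectionScale d t x) :
    Tendsto (fun n : ℕ+ => n * Real.log n ^ d * Real.exp (-((t n : ℝ) / n))) atTop
      (𝓝 (Real.exp (-x))) := by
  refine ((Real.continuous_exp.tendsto _).comp (Tendsto.neg h)).congr' ?_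
  filter_upwards [tendsto_log_pnat.eventually_gt_atTop 0] with n hn
  have h1 : -((t n : ℝ) / n - Real.log n - d * Real.log (Real.log n)) =
      Real.log n + Real.log (Real.log n ^ d) + -((t n : ℝ) / n) := by
    rw [Real.log_pow]; ring
  rw [Function.comp, h1, Real.exp_add, Real.exp_add, Real.exp_log (by positivity),
    Real.exp_log (by positivity)]

lemma tendsto_one_sub_pow (h : IsCollectionScale d t x) (a : ℕ) :
    Tendsto (fun n : ℕ+ => (1 - a / (n : ℝ)) ^ t n * (n * Real.log n ^ d) ^ a) atTop
      (𝓝 (Real.exp (-x) ^ a)) := by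
  have h1 := tendsto_one_sub_pow_mul_exp (u := fun n : ℕ+ => a / (n : ℝ)) (t := t)
    (tendsto_const_div_pnat a) (by
      have := h.tendsto_div_sq.const_mul ((a : ℝ) ^ 2)
      rw [mul_zero] at this
      refine this.congr fun n => ?_
      rw [div_pow]; ring)
  have h2 := h1.mul (h.tendsto_mul_exp.pow a)
  rw [one_mul] at h2
  refine h2.congr fun n => ?_
  rw [mul_pow _ (Real.exp _), ← Real.exp_nat_mul, mul_assoc, mul_comm (_ ^ a) (Real.exp _),
    ← mul_assoc (Real.exp _), ← Real.exp_add]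
  have : (t n : ℝ) * (a / (n : ℝ)) + a * -((t n : ℝ) / n) = 0 := by ring
  rw [this, Real.exp_zero, one_mul]

/-- Since `t / n ~ log n`, only the top term `i = d` survives division by `(log n) ^ d`. -/
lemma tendsto_sum_pow_div (h : IsCollectionScale d t x) :
    Tendsto (fun n : ℕ+ => (∑ i ∈ Finset.range (d + 1), ((t n : ℝ) / n) ^ i / i.factorial) /
      Real.log n ^ d) atTop (𝓝 (1 / d.factorial)) := by
  have h1 : ∀ i ∈ Finset.range (d + 1), Tendsto (fun n : ℕ+ =>
      ((t n : ℝ) / (n * Real.log n)) ^ i / i.factorial * (Real.log n ^ (d - i))⁻¹) atTop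
      (𝓝 (if i = d then 1 / d.factorial else 0)) := by
    intro i hi
    have h2 := (h.tendsto_div_mul_log.pow i).div_const (i.factorial : ℝ)
    rw [one_pow] at h2
    split_ifs with hid
    · subst hid
      simpa using h2
    · have h3 : Tendsto (fun n : ℕ+ => (Real.log n ^ (d - i))⁻¹) atTop (𝓝 0) :=
        (((tendsto_pow_atTop (by have := Finset.mem_range.1 hi; omega)).comp
          tendsto_log_pnat)).inv_tendsto_atTop
      simpa using h2.mul h3
  have h2 := tendsto_finsetSum _ h1
  rw [Finset.sum_ite_eq' , if_pos (by simp)] at h2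
  refine h2.congr' ?_
  filter_upwards [tendsto_log_pnat.eventually_gt_atTop 0] with n hn
  rw [Finset.sum_div]
  refine Finset.sum_congr rfl fun i hi => ?_
  have hi' : i ≤ d := by have := Finset.mem_range.1 hi; omega
  have h3 : Real.log n ^ d = Real.log n ^ i * Real.log n ^ (d - i) := by
    rw [← pow_add, Nat.add_sub_cancel' hi']
  rw [h3]
  rw [← div_div, div_pow _ (Real.log n)]
  field_simp

/-- Times on the same scale may be used in the power and in the Poisson sum. -/
lemma tendsto_sum_pow_mul (h : IsCollectionScale d t x) {t' : ℕ+ → ℕ} {y : ℝ}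
    (h' : IsCollectionScale d t' y) (a : ℕ) :
    Tendsto (fun n : ℕ+ => (n : ℝ) ^ a *
      ((∑ i ∈ Finset.range (d + 1), ((t' n : ℝ) / n) ^ i / i.factorial) ^ a *
        (1 - a / (n : ℝ)) ^ t n)) atTop (𝓝 ((Real.exp (-x) / d.factorial) ^ a)) := by
  have h1 := (h.tendsto_one_sub_pow a).mul (h'.tendsto_sum_pow_div.pow a)
  rw [← mul_pow, mul_one_div] at h1
  refine h1.congr' ?_
  filter_upwards [tendsto_log_pnat.eventually_gt_atTop 0] with n hn
  rw [mul_pow, div_pow]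
  field_simp

end IsCollectionScale

lemma tendsto_choose_div_pow (r : ℕ) :
    Tendsto (fun n : ℕ+ => ((n : ℕ).choose r : ℝ) / (n : ℝ) ^ r) atTop (𝓝 (1 / r.factorial)) := by
  have h1 := (isEquivalent_iff_tendsto_one ?_).1 (isEquivalent_choose r)
  · have h2 := (h1.div_const (r.factorial : ℝ)).comp tendsto_PNat_val_atTop_atTop
    refine h2.congr fun n => ?_
    simp only [Function.comp, Pi.div_apply]
    have h3 : ((PNat.val n : ℕ) : ℝ) ≠ 0 := by positivity
    field_simp
  · filter_upwards [eventually_ne_atTop 0] with n hn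
    have : (n : ℝ) ≠ 0 := by exact_mod_cast hn
    positivity

/-! ### Limit law of the completion time -/

section Family

variable {Ω : ℕ+ → Type*} [∀ n, MeasurableSpace (Ω n)] {P : (n : ℕ+) → Measure (Ω n)}
  {draw : (n : ℕ+) → ℕ → Ω n → Fin n} {d : ℕ} {t : ℕ+ → ℕ} {x : ℝ}

/-- These are the binomial moments of the number of incomplete types, with Poisson limits. The upper
and lower bounds involve the times `t` and `t - r * d`, which lie on the same scale, so they have a
common limit. -/
lemma tendsto_sum_powersetCard (hdraw : ∀ n, IsCouponSequence (P n) (draw n))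
    (ht : IsCollectionScale d t x) (r : ℕ) :
    Tendsto (fun n => ∑ s ∈ Finset.powersetCard r Finset.univ,
      (P n).real {ω | ∀ c ∈ s, copies (fun i => draw n i ω) (t n) c < d + 1}) atTop
      (𝓝 ((Real.exp (-x) / d.factorial) ^ r / r.factorial)) := by
  have ht' := ht.sub_const (r * d)
  have hlow := (tendsto_choose_div_pow r).mul (ht.tendsto_sum_pow_mul ht' r)
  have hup := (tendsto_choose_div_pow r).mul (ht'.tendsto_sum_pow_mul ht r)
  rw [one_div_mul_eq_div] at hlow hup
  have hcard : ∀ n : ℕ+, (Finset.powersetCard r (Finset.univ : Finset (Fin n))).card =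
      (n : ℕ).choose r := fun n => by simp
  refine tendsto_of_tendsto_of_tendsto_of_le_of_le' hlow hup ?_ ?_
  · filter_upwards [ht.eventually_le (r * d)] with n hn
    rw [← mul_assoc, div_mul_cancel₀ _ (by positivity), ← hcard, ← nsmul_eq_mul]
    refine Finset.card_nsmul_le_sum _ _ _ fun s hs => ?_
    obtain rfl := (Finset.mem_powersetCard.1 hs).2
    simpa using (hdraw n).le_measureReal_copies_lt n.ne_zero s (m := d + 1) (t := t n) (by simpa using hn)
  · filter_upwards [ht.eventually_le (r * d)] with n hn
    rw [← mul_assoc, div_mul_cancel₀ _ (by positivity), ← hcard, ← nsmul_eq_mul]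
    refine Finset.sum_le_card_nsmul _ _ _ fun s hs => ?_
    obtain rfl := (Finset.mem_powersetCard.1 hs).2
    simpa using (hdraw n).measureReal_copies_lt_le n.ne_zero s (m := d + 1) (t := t n) (by simpa using hn)

/-- Domination for the inclusion-exclusion series. Bernoulli's inequality `1 - r/n ≤ (1 - 1/n) ^ r`
and, for `r ≤ n`, the smaller exponent `t - n * d` reduce every `r` to the `r`-th power of the case
`r = 1`, which converges and so is bounded. -/
lemma eventually_sum_powersetCard_le (hdraw : ∀ n, IsCouponSequence (P n) (draw n))
    (ht : IsCollectionScale d t x) :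
    ∃ C : ℝ, 0 ≤ C ∧ ∀ᶠ n in atTop, ∀ r, ∑ s ∈ Finset.powersetCard r Finset.univ,
      (P n).real {ω | ∀ c ∈ s, copies (fun i => draw n i ω) (t n) c < d + 1} ≤
        C ^ r / r.factorial := by
  have h1 := (ht.sub_mul d).tendsto_sum_pow_mul ht 1
  obtain ⟨C, hC⟩ := h1.isBoundedUnder_le
  rw [eventually_map] at hC
  refine ⟨max C 0, le_max_right _ _, ?_⟩
  filter_upwards [hC, ht.eventually_mul_le d] with n hCn hn r
  by_cases hr : (n : ℕ) < r
  · rw [Finset.powersetCard_eq_empty.2 (by simpa using hr), Finset.sum_empty]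
    positivity
  rw [not_lt] at hr
  set S := ∑ i ∈ Finset.range (d + 1), ((t n : ℝ) / n) ^ i / i.factorial with hS
  have hS0 : 0 ≤ S := by positivity
  simp only [pow_one, Nat.cast_one] at hCn
  have hn1 : (1 : ℝ) ≤ n := by exact_mod_cast n.pos
  have hq : 0 ≤ 1 - 1 / (n : ℝ) := by rw [sub_nonneg, div_le_one (by positivity)]; exact hn1
  have hq1 : 1 - 1 / (n : ℝ) ≤ 1 := by
    have : 0 ≤ 1 / (n : ℝ) := by positivity
    linarith
  have hrd : r * d ≤ n * d := Nat.mul_le_mul_right _ hr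
  have hterm : ∀ s ∈ Finset.powersetCard r (Finset.univ : Finset (Fin n)),
      (P n).real {ω | ∀ c ∈ s, copies (fun i => draw n i ω) (t n) c < d + 1} ≤
        (S * (1 - 1 / (n : ℝ)) ^ (t n - n * d)) ^ r := by
    intro s hs
    obtain rfl := (Finset.mem_powersetCard.1 hs).2
    have h2 := (hdraw n).measureReal_copies_lt_le n.ne_zero s (m := d + 1) (t := t n)
      (by simpa using hrd.trans hn)
    refine h2.trans ?_
    rw [mul_pow, ← pow_mul, mul_comm (t n - n * d), pow_mul, Nat.add_sub_cancel]
    have h0 := IsCouponSequence.one_sub_card_div_nonneg s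
    have hbern : 1 - s.card / (n : ℝ) ≤ (1 - 1 / (n : ℝ)) ^ s.card := by
      have := one_add_mul_le_pow (a := - (1 / (n : ℝ))) (by linarith) s.card
      rw [← sub_eq_add_neg] at this
      refine le_trans (le_of_eq ?_) this
      ring
    refine mul_le_mul_of_nonneg_left ?_ (by positivity)
    calc (1 - s.card / (n : ℝ)) ^ (t n - s.card * d)
        ≤ ((1 - 1 / (n : ℝ)) ^ s.card) ^ (t n - s.card * d) := pow_le_pow_left₀ h0 hbern _
      _ ≤ _ := pow_le_pow_of_le_one (pow_nonneg hq _) (pow_le_one₀ hq hq1) (by omega)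
  refine (Finset.sum_le_card_nsmul _ _ _ hterm).trans ?_
  rw [Finset.card_powersetCard, Finset.card_univ, Fintype.card_fin, nsmul_eq_mul]
  calc ((n : ℕ).choose r : ℝ) * (S * (1 - 1 / (n : ℝ)) ^ (t n - n * d)) ^ r
      ≤ (n : ℝ) ^ r / r.factorial * (S * (1 - 1 / (n : ℝ)) ^ (t n - n * d)) ^ r := by
        gcongr
        exact Nat.choose_le_pow_div r n
    _ = (n * (S * (1 - 1 / (n : ℝ)) ^ (t n - n * d))) ^ r / r.factorial := by
        rw [mul_pow (n : ℝ)]; ring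
    _ ≤ (max C 0) ^ r / r.factorial := by
        gcongr
        exact hCn.trans (le_max_left _ _)

/-- The Erdős–Rényi limit theorem for the completion of `d + 1` collections. -/
theorem tendsto_measureReal_forall_le_copies (hdraw : ∀ n, IsCouponSequence (P n) (draw n))
    (ht : IsCollectionScale d t x) :
    Tendsto (fun n => (P n).real {ω | ∀ c, d + 1 ≤ copies (fun i => draw n i ω) (t n) c}) atTop
      (𝓝 (Real.exp (-(Real.exp (-x) / d.factorial)))) := by
  obtain ⟨C, hC0, hC⟩ := eventually_sum_powersetCard_le hdraw ht
  -- Inclusion-exclusion is read as an infinite series whose terms vanish for `r > n`.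
  have h1 := tendsto_tsum_of_dominated_convergence (𝓕 := atTop)
    (f := fun n r => (-1 : ℝ) ^ r * ∑ s ∈ Finset.powersetCard r Finset.univ,
      (P n).real {ω | ∀ c ∈ s, copies (fun i => draw n i ω) (t n) c < d + 1})
    (Real.summable_pow_div_factorial C)
    (fun r => (tendsto_sum_powersetCard hdraw ht r).const_mul ((-1 : ℝ) ^ r)) (by
      filter_upwards [hC] with n hn r
      rw [norm_mul, norm_pow, norm_neg, norm_one, one_pow, one_mul, Real.norm_of_nonneg
        (Finset.sum_nonneg fun _ _ => measureReal_nonneg)]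
      exact hn r)
  have h2 : ∑' r : ℕ, (-1 : ℝ) ^ r * ((Real.exp (-x) / d.factorial) ^ r / r.factorial) =
      Real.exp (-(Real.exp (-x) / d.factorial)) := by
    rw [Real.exp_eq_exp_ℝ, NormedSpace.exp_eq_tsum_div]
    refine tsum_congr fun r => ?_
    rw [neg_pow (_ / _), mul_div_assoc]
  rw [h2] at h1
  refine h1.congr fun n => ?_
  rw [(hdraw n).measureReal_forall_le_copies]
  refine tsum_eq_sum fun r hr => ?_
  rw [Finset.powersetCard_eq_empty.2, Finset.sum_empty, mul_zero]
  simpa using hr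

end Family

/-! ### First and second moment inequalities for counts of events -/

section Counting

variable {Ω : Type*} [MeasurableSpace Ω] {P : Measure Ω} [IsProbabilityMeasure P]
  {ι : Type*} [Fintype ι] {A : ι → Set Ω}

lemma integrable_indicator_one {B : Set Ω} (hB : MeasurableSet B) :
    Integrable (B.indicator (1 : Ω → ℝ)) P :=
  (integrable_const (1 : ℝ)).indicator hB

/-- Markov's inequality for the number of events that occur. -/
lemma measureReal_le_mul_sum_indicator (hA : ∀ i, MeasurableSet (A i)) {a : ℝ} (ha : 0 ≤ a) (δ : ℝ) :
    δ * P.real {ω | δ ≤ a * ∑ i, (A i).indicator (1 : Ω → ℝ) ω} ≤ a * ∑ i, P.real (A i) := by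
  have hint : Integrable (fun ω => a * ∑ i, (A i).indicator (1 : Ω → ℝ) ω) P :=
    (integrable_finsetSum _ fun i _ => integrable_indicator_one (hA i)).const_mul a
  refine (mul_meas_ge_le_integral_of_nonneg (ae_of_all _ fun ω => ?_) hint δ).trans_eq ?_
  · exact mul_nonneg ha (Finset.sum_nonneg fun i _ => Set.indicator_nonneg (fun _ _ => zero_le_one) ω)
  · rw [integral_const_mul, integral_finsetSum _ fun i _ => integrable_indicator_one (hA i)]
    simp_rw [integral_indicator_one (hA _)]

/-- Chebyshev's inequality, around an arbitrary centre, for the number of events that occur. -/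
lemma measureReal_le_abs_mul_sum_indicator_sub (hA : ∀ i, MeasurableSet (A i)) (a y : ℝ) {δ : ℝ}
    (hδ : 0 ≤ δ) :
    δ ^ 2 * P.real {ω | δ ≤ |a * ∑ i, (A i).indicator (1 : Ω → ℝ) ω - y|} ≤
      a ^ 2 * ∑ i, ∑ j, P.real (A i ∩ A j) - 2 * y * (a * ∑ i, P.real (A i)) + y ^ 2 := by
  -- The squared count is the number of ordered pairs of occurring events, so only pair
  -- probabilities are needed.
  have hsq : ∀ ω, (a * ∑ i, (A i).indicator (1 : Ω → ℝ) ω - y) ^ 2 =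
      a ^ 2 * ∑ i, ∑ j, (A i ∩ A j).indicator (1 : Ω → ℝ) ω -
        2 * y * (a * ∑ i, (A i).indicator (1 : Ω → ℝ) ω) + y ^ 2 := by
    intro ω
    have : ∑ i, ∑ j, (A i ∩ A j).indicator (1 : Ω → ℝ) ω =
        (∑ i, (A i).indicator (1 : Ω → ℝ) ω) ^ 2 := by
      rw [sq, Finset.sum_mul_sum]
      simp_rw [Set.inter_indicator_one]
      rfl
    rw [this]; ring
  have hset : {ω | δ ≤ |a * ∑ i, (A i).indicator (1 : Ω → ℝ) ω - y|} =
      {ω | δ ^ 2 ≤ (a * ∑ i, (A i).indicator (1 : Ω → ℝ) ω - y) ^ 2} := by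
    ext ω
    simp only [Set.mem_ofPred_eq]
    rw [sq_le_sq, abs_of_nonneg hδ]
  have h1 : Integrable (fun ω => ∑ i, (A i).indicator (1 : Ω → ℝ) ω) P :=
    integrable_finsetSum _ fun i _ => integrable_indicator_one (hA i)
  have h2 : Integrable (fun ω => ∑ i, ∑ j, (A i ∩ A j).indicator (1 : Ω → ℝ) ω) P :=
    integrable_finsetSum _ fun i _ => integrable_finsetSum _ fun j _ =>
      integrable_indicator_one ((hA i).inter (hA j))
  have h3 : Integrable (fun ω => a ^ 2 * ∑ i, ∑ j, (A i ∩ A j).indicator (1 : Ω → ℝ) ω -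
        2 * y * (a * ∑ i, (A i).indicator (1 : Ω → ℝ) ω)) P :=
    (h2.const_mul _).sub ((h1.const_mul a).const_mul (2 * y))
  rw [hset]
  refine (mul_meas_ge_le_integral_of_nonneg (ae_of_all _ fun ω => sq_nonneg _) ?_ _).trans_eq ?_
  · simp_rw [hsq]
    exact h3.add (integrable_const _)
  · simp_rw [hsq]
    rw [integral_add h3 (integrable_const _), integral_sub (h2.const_mul _)
      ((h1.const_mul a).const_mul (2 * y)), integral_const_mul, integral_const_mul,
      integral_const_mul, integral_finsetSum _ fun i _ => integrable_indicator_one (hA i),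
      integral_finsetSum _ fun i _ => integrable_finsetSum _ fun j _ =>
        integrable_indicator_one ((hA i).inter (hA j))]
    simp_rw [integral_finsetSum _ fun j _ => integrable_indicator_one ((hA _).inter (hA j)),
      integral_indicator_one (hA _), integral_indicator_one ((hA _).inter (hA _))]
    simp

end Counting

lemma card_filter_eq_sum_indicator {Ω ι : Type*} [Fintype ι] {A : ι → Set Ω} {ω : Ω} {p : ι → Prop} [DecidablePred p]
    (h : ∀ i, p i ↔ ω ∈ A i) :
    (((Finset.univ.filter p).card : ℕ) : ℝ) = ∑ i, (A i).indicator (1 : Ω → ℝ) ω := by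
  classical
  rw [Finset.card_filter, Nat.cast_sum]
  refine Finset.sum_congr rfl fun i _ => ?_
  simp [Set.indicator_apply, h i]


/-- The binomial probability of `j` successes among `t` trials of success probability `1 / n`. -/
noncomputable def tonProb (n t j : ℕ) : ℝ :=
  t.descFactorial j / (n : ℝ) ^ j / j.factorial * (1 - 1 / (n : ℝ)) ^ (t - j)

/-! ### Estimates for binomial probabilities -/

lemma one_sub_one_div_pos {n : ℕ} (hn : 1 < n) : 0 < 1 - 1 / (n : ℝ) := by
  have : (1 : ℝ) < n := by exact_mod_cast hn
  rw [sub_pos, div_lt_one (by positivity)]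
  exact this

lemma tonProb_nonneg {n : ℕ} (hn : 1 < n) (t j : ℕ) : 0 ≤ tonProb n t j := by
  have := one_sub_one_div_pos hn
  unfold tonProb
  positivity

/-- The ratio of consecutive probabilities is `(j + 1) n (1 - 1/n) / (t - j)`, at most `k n / (t -
k)` for `j < k`. -/
lemma tonProb_le_mul_succ {n t j k : ℕ} (hn : 1 < n) {ρ : ℝ} (hjk : j < k) (hkt : k ≤ t)
    (hρ : (k * n : ℝ) ≤ ρ * (t - k)) (hρ0 : 0 ≤ ρ) : tonProb n t j ≤ ρ * tonProb n t (j + 1) := by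
  have hq := one_sub_one_div_pos hn
  have hn0 : (n : ℝ) ≠ 0 := by positivity
  obtain ⟨u, rfl⟩ : ∃ u, t = j + 1 + u := ⟨t - (j + 1), by omega⟩
  unfold tonProb
  have e1 : j + 1 + u - j = u + 1 := by omega
  have e2 : j + 1 + u - (j + 1) = u := by omega
  rw [e1, e2, Nat.descFactorial_succ, e1, Nat.factorial_succ]
  set D : ℝ := ((j + 1 + u).descFactorial j : ℝ)
  set q := 1 - 1 / (n : ℝ)
  have hq1 : q ≤ 1 := by
    have : 0 ≤ 1 / (n : ℝ) := by positivity
    simp only [q]; linarith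
  have hmain : (j + 1 : ℝ) * n * q ≤ ρ * (u + 1) := by
    have h1 : (j + 1 : ℝ) ≤ k := by exact_mod_cast hjk
    have h2 : ρ * (((j + 1 + u : ℕ) : ℝ) - k) ≤ ρ * (u + 1) := by
      gcongr; push_cast; linarith
    calc (j + 1 : ℝ) * n * q ≤ (k : ℝ) * n * 1 := by gcongr
      _ ≤ _ := by rw [mul_one]; exact hρ.trans h2
  have e3 : D / (n : ℝ) ^ j / j.factorial * q ^ (u + 1) =
      D * q ^ u / ((n : ℝ) ^ (j + 1) * ((j + 1 : ℕ) * j.factorial : ℕ)) * ((j + 1 : ℝ) * n * q) := by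
    push_cast
    field_simp
    ring
  have e4 : ρ * (((((u + 1) * (j + 1 + u).descFactorial j : ℕ) : ℝ) / (n : ℝ) ^ (j + 1) /
      (((j + 1) * j.factorial : ℕ) : ℝ)) * q ^ u) =
      D * q ^ u / ((n : ℝ) ^ (j + 1) * ((j + 1 : ℕ) * j.factorial : ℕ)) * (ρ * (u + 1)) := by
    simp only [D]
    push_cast
    field_simp
  rw [e3, e4]
  gcongr

/-- Geometric decay below `k`: inductively the next partial sum is at most `(2ρ + 1) p_i ≤ 2 p_i ≤
2ρ p_{i+1}`, where `2ρ ≤ 1` is used. -/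
lemma sum_tonProb_le {n t k : ℕ} (hn : 1 < n) {ρ : ℝ} (hkt : k ≤ t)
    (hρ : (k * n : ℝ) ≤ ρ * (t - k)) (hρ0 : 0 ≤ ρ) (hρ1 : ρ ≤ 1 / 2) :
    ∑ j ∈ Finset.range k, tonProb n t j ≤ 2 * ρ * tonProb n t k := by
  have key : ∀ i ≤ k, ∑ j ∈ Finset.range i, tonProb n t j ≤ 2 * ρ * tonProb n t i := by
    intro i
    induction i with
    | zero =>
      intro _
      have := tonProb_nonneg hn t 0
      simp only [Finset.range_zero, Finset.sum_empty]
      positivity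
    | succ i ih =>
      intro hi
      have h1 := tonProb_le_mul_succ hn (by omega : i < k) hkt hρ hρ0
      have h2 := tonProb_nonneg hn t i
      rw [Finset.sum_range_succ]
      have := ih (by omega)
      nlinarith
  exact key k le_rfl

namespace IsCouponSequence

variable {Ω : Type*} [MeasurableSpace Ω] {P : Measure Ω} {n : ℕ} {draw : ℕ → Ω → Fin n}

lemma measureReal_copies_eq_tonProb (h : IsCouponSequence P draw) (c : Fin n) {t j : ℕ}
    (hj : j ≤ t) : P.real {ω | copies (fun i => draw i ω) t c = j} = tonProb n t j := by
  have := h.measureReal_copies_eq_div c.pos.ne' {c} (t := t) (j := fun _ => j) (by simpa using hj)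
  simpa [tonProb] using this

lemma measureReal_copies_lt_le_sum (h : IsCouponSequence P draw) (c : Fin n) {t k : ℕ}
    (hk : k ≤ t) : P.real {ω | copies (fun i => draw i ω) t c < k} ≤
      ∑ j ∈ Finset.range k, tonProb n t j := by
  have hset : {ω | copies (fun i => draw i ω) t c < k} =
      ⋃ j ∈ Finset.range k, {ω | copies (fun i => draw i ω) t c = j} := by
    ext ω; simp
  rw [hset]
  refine (measureReal_biUnion_finset_le _ _).trans (Finset.sum_le_sum fun j hj => ?_)
  rw [h.measureReal_copies_eq_tonProb c (by have := Finset.mem_range.1 hj; omega)]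

/-- Near-independence of two types, from `1 - 2/n ≤ (1 - 1/n)²` and submultiplicativity of the
falling factorial. The denominator compensates for the exponent `t - 2j` in place of `t - j`. -/
lemma measureReal_copies_eq_inter_le (h : IsCouponSequence P draw) (hn : 1 < n) {c c' : Fin n}
    (hc : c ≠ c') {t j : ℕ} (hj : 2 * j ≤ t) :
    P.real ({ω | copies (fun i => draw i ω) t c = j} ∩ {ω | copies (fun i => draw i ω) t c' = j}) ≤
      tonProb n t j ^ 2 / ((1 - 1 / (n : ℝ)) ^ j) ^ 2 := by
  have h1 := h.measureReal_copies_eq_div (by omega) {c, c'} (t := t) (j := fun _ => j)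
    (by simpa [hc] using hj)
  have hset : {ω | copies (fun i => draw i ω) t c = j} ∩ {ω | copies (fun i => draw i ω) t c' = j} =
      {ω | ∀ b ∈ ({c, c'} : Finset (Fin n)), copies (fun i => draw i ω) t b = j} := by
    ext ω; simp
  have h0 := one_sub_card_div_nonneg ({c, c'} : Finset (Fin n))
  rw [hset, h1]
  simp only [Finset.sum_const, Finset.prod_const, Finset.card_pair hc, smul_eq_mul] at h0 ⊢
  have hq := one_sub_one_div_pos hn
  set q := 1 - 1 / (n : ℝ) with hqdef
  have hbern : 1 - ((2 : ℕ) : ℝ) / n ≤ q ^ 2 := by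
    have : q ^ 2 - (1 - ((2 : ℕ) : ℝ) / n) = (1 / (n : ℝ)) ^ 2 := by
      rw [hqdef]; push_cast; ring
    nlinarith [sq_nonneg (1 / (n : ℝ))]
  have hD : (t.descFactorial (2 * j) : ℝ) ≤ (t.descFactorial j : ℝ) ^ 2 := by
    have : t.descFactorial (2 * j) ≤ t.descFactorial j * t.descFactorial j := by
      rw [← Nat.descFactorial_mul_descFactorial (by omega : j ≤ 2 * j), two_mul, Nat.add_sub_cancel]
      exact Nat.mul_le_mul_right _ (Nat.descFactorial_le _ (Nat.sub_le t j))
    rw [sq]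
    exact_mod_cast this
  have e : tonProb n t j ^ 2 / (q ^ j) ^ 2 =
      (t.descFactorial j : ℝ) ^ 2 / (n : ℝ) ^ (2 * j) / (j.factorial : ℝ) ^ 2 *
        (q ^ 2) ^ (t - 2 * j) := by
    obtain ⟨u, rfl⟩ : ∃ u, t = 2 * j + u := ⟨t - 2 * j, by omega⟩
    have e1 : 2 * j + u - j = j + u := by omega
    have e2 : 2 * j + u - 2 * j = u := by omega
    rw [tonProb, ← hqdef, e1, e2]
    rw [pow_add, ← mul_assoc, mul_right_comm, mul_pow _ (q ^ j), mul_div_cancel_right₀ _ (by positivity),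
      mul_pow, div_pow, div_pow, ← pow_mul, ← pow_mul, ← pow_mul, mul_comm j, mul_comm u]
  rw [e]
  gcongr

end IsCouponSequence

/-- The normalisation of the number of `k`-tons when `d + 1` collections are completed. -/
noncomputable def tonScale (d : ℕ) (k : ℕ+ → ℕ) (n : ℕ+) : ℝ :=
  (k n).factorial / Real.log n ^ (k n - (d + 1) + 1)

/-- The growth conditions on the multiplicities `k n` when `d + 1` collections are completed. -/
structure IsTonSequence (d : ℕ) (k : ℕ+ → ℕ) : Prop where
  le : ∀ᶠ n in atTop, d + 1 ≤ k n
  div_log : Tendsto (fun n : ℕ+ => (k n : ℝ) / Real.log n) atTop (𝓝 0)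
  mul_loglog_div_log :
    Tendsto (fun n : ℕ+ => (k n : ℝ) * (d * Real.log (Real.log n)) / Real.log n) atTop (𝓝 0)

lemma factorial_le_factorial_mul_pow {m k : ℕ} (h : m ≤ k) :
    k.factorial ≤ m.factorial * k ^ (k - m) := by
  obtain ⟨i, rfl⟩ := Nat.exists_eq_add_of_le h
  rw [← Nat.factorial_mul_ascFactorial, Nat.add_sub_cancel_left]
  refine Nat.mul_le_mul_left _ ?_
  refine (Nat.ascFactorial_le_pow_add _ _).trans (Nat.pow_le_pow_left ?_ _)
  omega

/-! ### Expected number of `k`-tons at a fixed time -/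

namespace IsTonSequence

variable {d : ℕ} {k : ℕ+ → ℕ}

lemma eventually_le_log (hk : IsTonSequence d k) : ∀ᶠ n : ℕ+ in atTop, (k n : ℝ) ≤ Real.log n := by
  filter_upwards [hk.div_log.eventually_le_const one_pos,
    tendsto_log_pnat.eventually_gt_atTop 0] with n hn h0
  rwa [div_le_one h0] at hn

lemma eventually_le_self (hk : IsTonSequence d k) : ∀ᶠ n : ℕ+ in atTop, k n ≤ n := by
  filter_upwards [hk.eventually_le_log] with n hn
  have := hn.trans (Real.log_le_self (Nat.cast_nonneg (n : ℕ)))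
  exact_mod_cast this

/-- Here `k! ≤ (d+1)! k^(k-d-1)` and `k ≤ log n` leave one spare factor `1 / log n`. This makes the
diagonal part of the second moment negligible. -/
lemma tendsto_tonScale (hk : IsTonSequence d k) : Tendsto (tonScale d k) atTop (𝓝 0) := by
  have h1 : Tendsto (fun n : ℕ+ => ((d + 1).factorial : ℝ) / Real.log n) atTop (𝓝 0) :=
    tendsto_const_nhds.div_atTop tendsto_log_pnat
  refine squeeze_zero' ?_ ?_ h1
  · filter_upwards [tendsto_log_pnat.eventually_gt_atTop 0] with n hn
    unfold tonScale; positivity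
  · filter_upwards [tendsto_log_pnat.eventually_gt_atTop 0, hk.le, hk.eventually_le_log]
      with n hn hle hlog
    unfold tonScale
    rw [div_le_div_iff₀ (by positivity) hn, pow_succ, ← mul_assoc]
    refine mul_le_mul_of_nonneg_right ?_ hn.le
    calc ((k n).factorial : ℝ) ≤ (d + 1).factorial * (k n : ℝ) ^ (k n - (d + 1)) := by
          exact_mod_cast factorial_le_factorial_mul_pow hle
      _ ≤ _ := by gcongr

lemma div_self (hk : IsTonSequence d k) : Tendsto (fun n : ℕ+ => (k n : ℝ) / n) atTop (𝓝 0) := by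
  have := hk.div_log.mul tendsto_log_div_pnat
  rw [mul_zero] at this
  refine this.congr' ?_
  filter_upwards [tendsto_log_pnat.eventually_gt_atTop 0] with n hn
  field_simp

lemma tendsto_one_sub_pow (hk : IsTonSequence d k) :
    Tendsto (fun n : ℕ+ => (1 - 1 / (n : ℝ)) ^ k n) atTop (𝓝 1) := by
  have := tendsto_one_add_pow_one (e := fun n : ℕ+ => -(1 / (n : ℝ))) (k := k)
    (by simpa using (tendsto_const_div_pnat 1).neg)
    (by simpa [div_eq_mul_inv] using hk.div_self.neg)
  simpa [sub_eq_add_neg] using this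

variable {t : ℕ+ → ℕ} {x : ℝ}

lemma eventually_two_mul_le (hk : IsTonSequence d k) (ht : IsCollectionScale d t x) :
    ∀ᶠ n in atTop, 2 * k n ≤ t n := by
  filter_upwards [hk.eventually_le_self, ht.eventually_mul_le 2] with n h1 h2
  omega

/-- The falling factorial lies between `(t - k)^k` and `t^k`. Relative to `(n log n)^k` both are of
the form `(1 + e)^k` with `k e → 0`, by the growth conditions. -/
lemma tendsto_descFactorial_div (hk : IsTonSequence d k) (ht : IsCollectionScale d t x) :
    Tendsto (fun n : ℕ+ => ((t n).descFactorial (k n) : ℝ) / (n * Real.log n) ^ k n) atTop (𝓝 1) := by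
  have he := ht.tendsto_div_mul_log.sub_const 1
  rw [sub_self] at he
  have hke := ht.tendsto_div_mul_log_sub_one_mul hk.mul_loglog_div_log hk.div_log
  have hc : Tendsto (fun n : ℕ+ => (k n : ℝ) / (n * Real.log n)) atTop (𝓝 0) := by
    have := hk.div_log.mul (tendsto_const_div_pnat 1)
    rw [mul_zero] at this
    refine this.congr fun n => ?_
    ring
  have hkc : Tendsto (fun n : ℕ+ => (k n : ℝ) * (k n / (n * Real.log n))) atTop (𝓝 0) := by
    have := hk.div_log.mul hk.div_self
    rw [mul_zero] at this
    refine this.congr fun n => ?_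
    ring
  have hup := tendsto_one_add_pow_one he hke
  have hlow := tendsto_one_add_pow_one (k := k) (by simpa using he.sub hc)
    (by simpa [mul_sub] using hke.sub hkc)
  refine tendsto_of_tendsto_of_tendsto_of_le_of_le' hlow hup ?_ ?_
  · filter_upwards [hk.eventually_two_mul_le ht, tendsto_log_pnat.eventually_gt_atTop 0] with n h1 h2
    have h3 : (1 + ((t n : ℝ) / (n * Real.log n) - 1 - k n / (n * Real.log n))) =
        ((t n - k n : ℕ) : ℝ) / (n * Real.log n) := by
      rw [Nat.cast_sub (by omega)]; ring
    rw [h3, div_pow]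
    gcongr
    exact_mod_cast (Nat.pow_le_pow_left (by omega) _).trans (Nat.pow_sub_le_descFactorial (t n) (k n))
  · filter_upwards [tendsto_log_pnat.eventually_gt_atTop 0] with n h2
    rw [add_sub_cancel, div_pow]
    gcongr
    exact_mod_cast Nat.descFactorial_le_pow _ _

/-- The expected number of `k`-tons at a fixed time. -/
lemma tendsto_tonScale_mul_tonProb (hk : IsTonSequence d k) (ht : IsCollectionScale d t x) :
    Tendsto (fun n : ℕ+ => tonScale d k n * (n * tonProb n (t n) (k n))) atTop
      (𝓝 (Real.exp (-x))) := by
  have h1 := (hk.tendsto_descFactorial_div ht).mul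
    ((ht.tendsto_one_sub_pow 1).div hk.tendsto_one_sub_pow one_ne_zero)
  simp only [pow_one, one_mul, div_one, Nat.cast_one] at h1
  refine h1.congr' ?_
  filter_upwards [hk.eventually_two_mul_le ht, tendsto_log_pnat.eventually_gt_atTop 0, hk.le,
    eventually_gt_atTop 1] with n h2 h3 h4 h5
  have hq := one_sub_one_div_pos (n := n) (by exact_mod_cast h5)
  obtain ⟨u, hu⟩ : ∃ u, t n = u + k n := ⟨t n - k n, by omega⟩
  obtain ⟨v, hv⟩ : ∃ v, k n = d + 1 + v := ⟨k n - (d + 1), by omega⟩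
  have hn : (n : ℝ) ≠ 0 := by positivity
  -- One part of the power is the normalisation of the count, the other cancels the `(log n) ^ d`
  -- coming from `(1 - 1/n) ^ t`.
  have hL : Real.log n ^ k n = Real.log n ^ (k n - (d + 1) + 1) * Real.log n ^ d := by
    rw [← pow_add]; congr 1; omega
  have hF : ((k n).factorial : ℝ) ≠ 0 := by positivity
  simp only [Pi.div_apply]
  unfold tonScale tonProb
  rw [mul_pow, hL, hu, pow_add (1 - 1 / (n : ℝ)), Nat.add_sub_cancel]
  set q := 1 - 1 / (n : ℝ)
  field_simp

end IsTonSequence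

/-! ### Concentration at a fixed time -/

section Family

variable {Ω : ℕ+ → Type*} [∀ n, MeasurableSpace (Ω n)] {P : (n : ℕ+) → Measure (Ω n)}
  [∀ n, IsProbabilityMeasure (P n)]
  {draw : (n : ℕ+) → ℕ → Ω n → Fin n} {d : ℕ} {k t : ℕ+ → ℕ} {x : ℝ}

/-- At a fixed time, the scaled number of `k`-tons concentrates. -/
lemma tendsto_measureReal_tons_sub (hdraw : ∀ n, IsCouponSequence (P n) (draw n))
    (hk : IsTonSequence d k) (ht : IsCollectionScale d t x) {δ : ℝ} (hδ : 0 < δ) :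
    Tendsto (fun n => (P n).real {ω | δ ≤ |tonScale d k n * ((Finset.univ.filter fun c =>
      copies (fun i => draw n i ω) (t n) c = k n).card : ℝ) - Real.exp (-x)|}) atTop (𝓝 0) := by
  set y := Real.exp (-x) with hy
  have hM := hk.tendsto_tonScale_mul_tonProb ht
  -- The diagonal term tends to `0`, the off-diagonal one to `y²`, and `y² - 2 y² + y² = 0`.
  have hlim : Tendsto (fun n : ℕ+ => (tonScale d k n * (tonScale d k n * (n * tonProb n (t n) (k n))) +
      (tonScale d k n * (n * tonProb n (t n) (k n))) ^ 2 / ((1 - 1 / (n : ℝ)) ^ k n) ^ 2 -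
      2 * y * (tonScale d k n * (n * tonProb n (t n) (k n))) + y ^ 2) / δ ^ 2) atTop (𝓝 0) := by
    have h1 := ((((hk.tendsto_tonScale.mul hM).add ((hM.pow 2).div (hk.tendsto_one_sub_pow.pow 2)
      (by norm_num))).sub (hM.const_mul (2 * y))).add_const (y ^ 2)).div_const (δ ^ 2)
    refine (h1.congr fun n => rfl).trans (le_of_eq ?_)
    congr 1
    ring
  refine squeeze_zero' (Eventually.of_forall fun n => measureReal_nonneg) ?_ hlim
  filter_upwards [hk.eventually_two_mul_le ht, eventually_gt_atTop 1] with n h2 h3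
  have hn : 1 < (n : ℕ) := by exact_mod_cast h3
  have hq := one_sub_one_div_pos hn
  have hp := tonProb_nonneg hn (t n) (k n)
  let A : Fin n → Set (Ω n) := fun c => {ω | copies (fun i => draw n i ω) (t n) c = k n}
  have hA : ∀ c, MeasurableSet (A c) := fun c =>
    (hdraw n).measurableSet_copies' (t n) fun v => v c = k n
  have hA1 : ∀ c, (P n).real (A c) = tonProb n (t n) (k n) := fun c =>
    (hdraw n).measureReal_copies_eq_tonProb c (by omega)
  have hcheb := measureReal_le_abs_mul_sum_indicator_sub (P := P n) hA (tonScale d k n) y hδ.le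
  have hcard : ∀ ω, ((Finset.univ.filter fun c =>
      copies (fun i => draw n i ω) (t n) c = k n).card : ℝ) =
      ∑ c, (A c).indicator (1 : Ω n → ℝ) ω := fun ω =>
    card_filter_eq_sum_indicator fun c => Iff.rfl
  simp_rw [hcard]
  rw [le_div_iff₀ (by positivity), mul_comm]
  refine hcheb.trans ?_
  have hsum1 : ∑ c, (P n).real (A c) = n * tonProb n (t n) (k n) := by
    simp [hA1]
  have hsum2 : ∑ c, ∑ c', (P n).real (A c ∩ A c') ≤ n * tonProb n (t n) (k n) +
      (n * tonProb n (t n) (k n)) ^ 2 / ((1 - 1 / (n : ℝ)) ^ k n) ^ 2 := by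
    have hpair : ∀ c c', (P n).real (A c ∩ A c') ≤ (if c = c' then tonProb n (t n) (k n) else 0) +
        tonProb n (t n) (k n) ^ 2 / ((1 - 1 / (n : ℝ)) ^ k n) ^ 2 := by
      intro c c'
      split_ifs with hcc
      · subst hcc
        rw [Set.inter_self, hA1]
        have : 0 ≤ tonProb n (t n) (k n) ^ 2 / ((1 - 1 / (n : ℝ)) ^ k n) ^ 2 := by positivity
        linarith
      · rw [zero_add]
        exact (hdraw n).measureReal_copies_eq_inter_le hn hcc h2
    refine (Finset.sum_le_sum fun c _ => Finset.sum_le_sum fun c' _ => hpair c c').trans_eq ?_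
    simp [Finset.sum_add_distrib]
    ring
  rw [hsum1]
  have := mul_le_mul_of_nonneg_left hsum2 (sq_nonneg (tonScale d k n))
  calc _ ≤ (tonScale d k n) ^ 2 * (n * tonProb n (t n) (k n) +
      (n * tonProb n (t n) (k n)) ^ 2 / ((1 - 1 / (n : ℝ)) ^ k n) ^ 2) -
      2 * y * (tonScale d k n * (n * tonProb n (t n) (k n))) + y ^ 2 := by linarith
    _ = _ := by ring

/-- At a fixed time, types with fewer than `k` copies are negligible compared with `k`-tons. -/
lemma tendsto_measureReal_lt_tons (hdraw : ∀ n, IsCouponSequence (P n) (draw n))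
    (hk : IsTonSequence d k) (ht : IsCollectionScale d t x) {δ : ℝ} (hδ : 0 < δ) :
    Tendsto (fun n => (P n).real {ω | δ ≤ tonScale d k n * ((Finset.univ.filter fun c =>
      copies (fun i => draw n i ω) (t n) c < k n).card : ℝ)}) atTop (𝓝 0) := by
  have hM := hk.tendsto_tonScale_mul_tonProb ht
  -- The smallest ratio admitted by `sum_tonProb_le`; it is asymptotic to `k / log n`.
  let ρ : ℕ+ → ℝ := fun n => k n * n / (t n - k n)
  have hρ : Tendsto ρ atTop (𝓝 0) := by
    have h1 : Tendsto (fun n : ℕ+ => (t n : ℝ) / (n * Real.log n) - k n / (n * Real.log n)) atTop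
        (𝓝 (1 - 0)) := by
      refine ht.tendsto_div_mul_log.sub ?_
      have := hk.div_log.mul (tendsto_const_div_pnat 1)
      rw [mul_zero] at this
      refine this.congr fun n => ?_
      ring
    have h2 := hk.div_log.div h1 (by norm_num)
    rw [zero_div] at h2
    refine h2.congr' ?_
    filter_upwards [tendsto_log_pnat.eventually_gt_atTop 0] with n hn
    have : (n : ℝ) ≠ 0 := by positivity
    simp only [ρ, Pi.div_apply]
    rw [← sub_div, div_div_eq_mul_div]
    field_simp
  have hlim : Tendsto (fun n : ℕ+ => 2 * ρ n * (tonScale d k n * (n * tonProb n (t n) (k n))) / δ)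
      atTop (𝓝 0) := by
    simpa using ((hρ.const_mul 2).mul hM).div_const δ
  refine squeeze_zero' (Eventually.of_forall fun n => measureReal_nonneg) ?_ hlim
  filter_upwards [hk.eventually_two_mul_le ht, eventually_gt_atTop 1, hk.le,
    hρ.eventually_le_const (by norm_num : (0 : ℝ) < 1 / 2),
    tendsto_log_pnat.eventually_gt_atTop 0] with n h2 h3 h4 h5 h6
  have hn : 1 < (n : ℕ) := by exact_mod_cast h3
  have hkt : (0 : ℝ) < t n - k n := by
    rw [sub_pos]; exact_mod_cast (by omega : k n < t n)
  have ha : 0 ≤ tonScale d k n := by unfold tonScale; positivity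
  let A : Fin n → Set (Ω n) := fun c => {ω | copies (fun i => draw n i ω) (t n) c < k n}
  have hA : ∀ c, MeasurableSet (A c) := fun c =>
    (hdraw n).measurableSet_copies' (t n) fun v => v c < k n
  have hcard : ∀ ω, ((Finset.univ.filter fun c =>
      copies (fun i => draw n i ω) (t n) c < k n).card : ℝ) =
      ∑ c, (A c).indicator (1 : Ω n → ℝ) ω := fun ω =>
    card_filter_eq_sum_indicator fun c => Iff.rfl
  simp_rw [hcard]
  rw [le_div_iff₀ hδ, mul_comm]
  refine (measureReal_le_mul_sum_indicator hA ha δ).trans ?_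
  have hA1 : ∀ c, (P n).real (A c) ≤ 2 * ρ n * tonProb n (t n) (k n) := fun c =>
    ((hdraw n).measureReal_copies_lt_le_sum c (by omega)).trans
      (sum_tonProb_le hn (by omega) (by simp only [ρ]; rw [div_mul_cancel₀ _ hkt.ne'])
        (by simp only [ρ]; positivity) h5)
  calc tonScale d k n * ∑ c, (P n).real (A c)
      ≤ tonScale d k n * ∑ _c : Fin n, 2 * ρ n * tonProb n (t n) (k n) := by
        gcongr with c
        exact hA1 c
    _ = _ := by simp; ring

end Family

/-! ### Criteria for convergence in distribution -/

section Distribution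

variable {ι Ω' : Type*} {Ω : ι → Type*} [∀ i, MeasurableSpace (Ω i)]
  {μ : (i : ι) → Measure (Ω i)} [∀ i, IsProbabilityMeasure (μ i)]
  [MeasurableSpace Ω'] {μ' : Measure Ω'} [IsProbabilityMeasure μ'] {l : Filter ι}
  [l.IsCountablyGenerated]

/-- If `X i` converges in distribution and `Y i - X i` converges to `0` in probability, then `Y i`
has the same limit; the probability spaces may vary with `i`. -/
lemma tendstoInDistribution_of_tendsto_measureReal_sub {E : Type*} [NormedAddCommGroup E]
    [SecondCountableTopology E] [MeasurableSpace E] [BorelSpace E] {X Y : (i : ι) → Ω i → E}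
    {Z : Ω' → E} (hXZ : TendstoInDistribution X l Z μ μ')
    (hXY : ∀ ε > 0, Tendsto (fun i => (μ i).real {ω | ε ≤ ‖Y i ω - X i ω‖}) l (𝓝 0))
    (hY : ∀ i, AEMeasurable (Y i) (μ i)) : TendstoInDistribution Y l Z μ μ' := by
  have hZ : AEMeasurable Z μ' := hXZ.aemeasurable_limit
  have hX : ∀ i, AEMeasurable (X i) (μ i) := hXZ.forall_aemeasurable
  refine ⟨hY, hZ, tendsto_iff_forall_lipschitz_integral_tendsto.2 ?_⟩
  rintro F ⟨M, hM⟩ ⟨K, hK⟩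
  have hFc : Continuous F := hK.continuous
  have hM0 : 0 ≤ M := dist_nonneg.trans (hM 0 0)
  have hXlim := tendsto_iff_forall_lipschitz_integral_tendsto.1 hXZ.tendsto F ⟨M, hM⟩ ⟨K, hK⟩
  suffices h : Tendsto (fun i => (∫ ω, F ω ∂(μ i).map (Y i)) - ∫ ω, F ω ∂(μ i).map (X i)) l (𝓝 0) by
    simpa using h.add hXlim
  have hint : ∀ i, ∀ W : Ω i → E, AEMeasurable W (μ i) → Integrable (fun ω => F (W ω)) (μ i) := by
    intro i W hW
    refine Integrable.of_bound (hFc.measurable.comp_aemeasurable hW).aestronglyMeasurable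
      (‖F 0‖ + M) (ae_of_all _ fun ω => ?_)
    have := hM (W ω) 0
    rw [dist_eq_norm] at this
    linarith [norm_sub_norm_le (F (W ω)) (F 0)]
  -- Where `X` and `Y` are within `ε` the Lipschitz constant `K` controls the difference; elsewhere
  -- the oscillation bound `M` does.
  have hbound : ∀ ε > 0, ∀ i, |(∫ ω, F ω ∂(μ i).map (Y i)) - ∫ ω, F ω ∂(μ i).map (X i)| ≤
      K * ε + M * (μ i).real {ω | ε ≤ ‖Y i ω - X i ω‖} := by
    intro ε hε i
    have hnull : NullMeasurableSet {ω | ε ≤ ‖Y i ω - X i ω‖} (μ i) :=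
      nullMeasurableSet_le aemeasurable_const ((hY i).sub (hX i)).norm
    rw [integral_map (hY i) hFc.aestronglyMeasurable, integral_map (hX i) hFc.aestronglyMeasurable,
      ← integral_sub (hint i _ (hY i)) (hint i _ (hX i)), ← Real.norm_eq_abs]
    have hind : Integrable ({ω | ε ≤ ‖Y i ω - X i ω‖}.indicator fun _ => M) (μ i) :=
      (integrable_const M).indicator₀ hnull
    calc ‖∫ ω, F (Y i ω) - F (X i ω) ∂μ i‖
        ≤ ∫ ω, (K * ε + {ω | ε ≤ ‖Y i ω - X i ω‖}.indicator (fun _ => M) ω) ∂μ i := by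
          refine norm_integral_le_of_norm_le ((integrable_const _).add hind) (ae_of_all _ fun ω => ?_)
          by_cases hω : ε ≤ ‖Y i ω - X i ω‖
          · rw [Set.indicator_of_mem (by exact hω), ← dist_eq_norm]
            have := hM (Y i ω) (X i ω)
            have : 0 ≤ K * ε := by positivity
            linarith
          · rw [Set.indicator_of_notMem (by exact hω), add_zero]
            exact hK.norm_sub_le_of_le (not_le.1 hω).le
      _ = _ := by
          rw [integral_add (integrable_const _) hind, integral_indicator₀ hnull]
          simp [mul_comm]
  rw [Metric.tendsto_nhds]
  intro ε hε
  have hpos : 0 < ε / (2 * (K + 1)) := by positivity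
  have h1 := (hXY _ hpos).const_mul M
  rw [mul_zero] at h1
  filter_upwards [h1.eventually_lt_const (half_pos hε)] with i hi
  rw [Real.dist_eq, sub_zero]
  refine (hbound _ hpos i).trans_lt ?_
  have : K * (ε / (2 * (K + 1))) ≤ ε / 2 := by
    rw [mul_div_assoc', div_le_div_iff₀ (by positivity) (by positivity)]
    nlinarith [K.coe_nonneg]
  linarith

/-- Pointwise convergence of distribution functions implies convergence in distribution. -/
lemma tendstoInDistribution_of_tendsto_measureReal_le {X : (i : ι) → Ω i → ℝ} {Z : Ω' → ℝ}
    (hX : ∀ i, AEMeasurable (X i) (μ i)) (hZ : AEMeasurable Z μ')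
    (h : ∀ x, Tendsto (fun i => (μ i).real {ω | X i ω ≤ x}) l (𝓝 (μ'.real {ω | Z ω ≤ x}))) :
    TendstoInDistribution X l Z μ μ' := by
  refine ⟨hX, hZ, ?_⟩
  -- Half-open intervals form a π-system containing arbitrarily small neighbourhoods, and their
  -- measures are differences of distribution function values.
  have hpi : IsPiSystem {s : Set ℝ | ∃ a b, a < b ∧ Set.Ioc a b = s} := isPiSystem_Ioc id id
  have hIoc : ∀ (ν : Measure ℝ) [IsProbabilityMeasure ν] {a b : ℝ}, a ≤ b →
      ν.real (Set.Ioc a b) = ν.real (Set.Iic b) - ν.real (Set.Iic a) := by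
    intro ν _ a b hab
    rw [← Set.Iic_sdiff_Iic, measureReal_sdiff (Set.Iic_subset_Iic.2 hab) measurableSet_Iic]
  have hmapX : ∀ i x, ((μ i).map (X i)).real (Set.Iic x) = (μ i).real {ω | X i ω ≤ x} := fun i x => by
    rw [Measure.real, Measure.map_apply_of_aemeasurable (hX i) measurableSet_Iic]; rfl
  have hmapZ : ∀ x, (μ'.map Z).real (Set.Iic x) = μ'.real {ω | Z ω ≤ x} := fun x => by
    rw [Measure.real, Measure.map_apply_of_aemeasurable hZ measurableSet_Iic]; rfl
  refine hpi.tendsto_probabilityMeasure_of_tendsto_of_mem ?_ ?_ ?_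
  · rintro _ ⟨a, b, -, rfl⟩
    exact measurableSet_Ioc
  · intro u hu x hx
    obtain ⟨a, b, hxab, hab⟩ := mem_nhds_iff_exists_Ioo_subset.1 (hu.mem_nhds hx)
    obtain ⟨c, hxc, hcb⟩ := exists_between hxab.2
    exact ⟨Set.Ioc a c, ⟨a, c, hxab.1.trans hxc, rfl⟩, Ioc_mem_nhds hxab.1 hxc,
      (Set.Ioc_subset_Ioo_right hcb).trans hab⟩
  · rintro _ ⟨a, b, hab, rfl⟩
    rw [← NNReal.tendsto_coe]
    have h1 := (h b).sub (h a)
    rw [← hmapZ, ← hmapZ] at h1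
    simp_rw [← hmapX] at h1
    have := Measure.isProbabilityMeasure_map hZ
    have := fun i => Measure.isProbabilityMeasure_map (hX i)
    rw [← hIoc (μ'.map Z) hab.le] at h1
    refine h1.congr fun i => ?_
    rw [← hIoc _ hab.le]
    rfl

end Distribution

/-! ### Pathwise comparison and measurability of `T` and `S_k` -/

section Deterministic

variable {n m : ℕ} {x : ℕ → Fin n}

lemma collectionTime_le {t : ℕ} (h : ∀ c, m ≤ copies x t c) : collectionTime m x ≤ t :=
  Nat.sInf_le h

lemma le_copies_collectionTime {t : ℕ} (h : ∀ c, m ≤ copies x t c) (c : Fin n) :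
    m ≤ copies x (collectionTime m x) c :=
  Nat.sInf_mem (s := {t | ∀ c, m ≤ copies x t c}) ⟨t, h⟩ c

lemma collectionTime_le_iff {t : ℕ} (h : ∃ t, ∀ c, m ≤ copies x t c) :
    collectionTime m x ≤ t ↔ ∀ c, m ≤ copies x t c := by
  obtain ⟨s, hs⟩ := h
  exact ⟨fun ht c => (le_copies_collectionTime hs c).trans (copies_mono x c ht), collectionTime_le⟩

lemma collectionTime_eq_zero (h : ¬ ∃ t, ∀ c, m ≤ copies x t c) : collectionTime m x = 0 := by
  have : {t | ∀ c, m ≤ copies x t c} = ∅ := by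
    ext t; simpa using not_exists.1 h t
  rw [collectionTime, this, Nat.sInf_empty]

/-- A type with `k` copies at time `t` had at most `k` at time `s`. This is used both to leave and
to reach the completion time. -/
lemma card_copies_eq_le {s t k : ℕ} (h : s ≤ t) :
    (Finset.univ.filter fun c => copies x t c = k).card ≤
      (Finset.univ.filter fun c => copies x s c = k).card +
        (Finset.univ.filter fun c => copies x s c < k).card := by
  refine (Finset.card_le_card fun c hc => ?_).trans (Finset.card_union_le _ _)
  have := copies_mono x c h
  simp only [Finset.mem_filter, Finset.mem_union, Finset.mem_univ, true_and] at hc ⊢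
  dsimp only at this
  omega

lemma card_copies_lt_anti {s t k : ℕ} (h : s ≤ t) :
    (Finset.univ.filter fun c => copies x t c < k).card ≤
      (Finset.univ.filter fun c => copies x s c < k).card := by
  refine Finset.card_le_card fun c hc => ?_
  have := copies_mono x c h
  simp only [Finset.mem_filter, Finset.mem_univ, true_and] at hc ⊢
  exact this.trans_lt hc

end Deterministic

namespace IsCouponSequence

variable {Ω : Type*} [MeasurableSpace Ω] {P : Measure Ω} {n : ℕ} {draw : ℕ → Ω → Fin n}

lemma measurableSet_exists_forall_le_copies (h : IsCouponSequence P draw) (m : ℕ) :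
    MeasurableSet {ω | ∃ t, ∀ c, m ≤ copies (fun i => draw i ω) t c} := by
  have : {ω | ∃ t, ∀ c, m ≤ copies (fun i => draw i ω) t c} =
      ⋃ t, {ω | ∀ c, m ≤ copies (fun i => draw i ω) t c} := by ext; simp
  rw [this]
  exact MeasurableSet.iUnion fun t => h.measurableSet_copies' t fun v => ∀ c, m ≤ v c

lemma measurable_collectionTime (h : IsCouponSequence P draw) (m : ℕ) :
    Measurable fun ω => collectionTime m fun i => draw i ω := by
  refine measurable_of_Iic fun t => ?_
  -- The second set appears because `collectionTime` is `0` when the collection is never completed.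
  have : (fun ω => collectionTime m fun i => draw i ω) ⁻¹' Set.Iic t =
      {ω | ∀ c, m ≤ copies (fun i => draw i ω) t c} ∪
        {ω | ∃ t, ∀ c, m ≤ copies (fun i => draw i ω) t c}ᶜ := by
    ext ω
    simp only [Set.mem_preimage, Set.mem_Iic, Set.mem_union, Set.mem_ofPred_eq, Set.mem_compl_iff]
    by_cases hω : ∃ t, ∀ c, m ≤ copies (fun i => draw i ω) t c
    · rw [collectionTime_le_iff hω]; simp [hω]
    · rw [collectionTime_eq_zero hω]; simp [hω]
  rw [this]
  exact (h.measurableSet_copies' t fun v => ∀ c, m ≤ v c).union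
    (h.measurableSet_exists_forall_le_copies m).compl

lemma measurable_numTons (h : IsCouponSequence P draw) (m k : ℕ) :
    Measurable fun ω => numTons m k fun i => draw i ω := by
  let F : (Fin n → ℕ) → ℕ := fun v => (Finset.univ.filter fun c => v c = k).card
  -- The time coordinate is countable, so joint measurability follows from measurability at each
  -- fixed time.
  have h1 : Measurable fun p : ℕ × Ω => F (copies (fun i => draw i p.2) p.1) :=
    measurable_from_prod_countable_right fun t =>
      (measurable_of_countable F).comp (h.measurable_copies t)
  have h2 : Measurable fun ω => (collectionTime m fun i => draw i ω, ω) :=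
    (h.measurable_collectionTime m).prodMk measurable_id
  have h3 := h1.comp h2
  unfold numTons
  exact h3

end IsCouponSequence

/-- `n log n + d n log (log n) + x n`, rounded down. -/
noncomputable def collectionFloor (d : ℕ) (x : ℝ) (n : ℕ+) : ℕ :=
  ⌊(n : ℝ) * (Real.log n + d * Real.log (Real.log n) + x)⌋₊

lemma eventually_collectionFloor_arg_nonneg (d : ℕ) (x : ℝ) :
    ∀ᶠ n : ℕ+ in atTop, 0 ≤ (n : ℝ) * (Real.log n + d * Real.log (Real.log n) + x) := by
  have h1 := Real.tendsto_log_atTop.comp tendsto_log_pnat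
  filter_upwards [h1.eventually_ge_atTop 0, tendsto_log_pnat.eventually_ge_atTop (-x)] with n h2 h3
  simp only [Function.comp] at h2
  have : 0 ≤ d * Real.log (Real.log n) := by positivity
  exact mul_nonneg (Nat.cast_nonneg _) (by linarith)

lemma isCollectionScale_collectionFloor (d : ℕ) (x : ℝ) :
    IsCollectionScale d (collectionFloor d x) x := by
  have h1 : Tendsto (fun n : ℕ+ => x - 1 / (n : ℝ)) atTop (𝓝 x) := by
    simpa using tendsto_const_nhds.sub (tendsto_const_div_pnat 1)
  refine tendsto_of_tendsto_of_tendsto_of_le_of_le' h1 tendsto_const_nhds ?_ ?_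
  · refine Eventually.of_forall fun n => ?_
    have hn : (0 : ℝ) < n := by positivity
    have h2 := Nat.lt_floor_add_one ((n : ℝ) * (Real.log n + d * Real.log (Real.log n) + x))
    change _ < (collectionFloor d x n : ℝ) + 1 at h2
    rw [mul_comm, ← lt_div_iff₀ hn, add_div] at h2
    linarith
  · filter_upwards [eventually_collectionFloor_arg_nonneg d x] with n h0
    have hn : (0 : ℝ) < n := by positivity
    have h2 := Nat.floor_le h0
    change (collectionFloor d x n : ℝ) ≤ _ at h2
    rw [mul_comm, ← div_le_iff₀ hn] at h2
    linarith

/-- The centred and scaled value of a collection time. -/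
noncomputable def centredTime (d : ℕ) (n : ℕ+) (T : ℕ) : ℝ :=
  ((T : ℝ) - (n : ℝ) * Real.log n - (((d + 1 : ℕ) : ℝ) - 1) * (n : ℝ) * Real.log (Real.log n)) / (n : ℝ)

lemma centredTime_le_iff {d : ℕ} {x : ℝ} {n : ℕ+} {T : ℕ}
    (h : 0 ≤ (n : ℝ) * (Real.log n + d * Real.log (Real.log n) + x)) :
    centredTime d n T ≤ x ↔ T ≤ collectionFloor d x n := by
  have hn : (0 : ℝ) < n := by positivity
  rw [collectionFloor, Nat.le_floor_iff h, centredTime, div_le_iff₀ hn]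
  push_cast
  constructor <;> intro h <;> linarith

/-! ### Transfer from fixed times to the completion time -/

section Family

variable {Ω : ℕ+ → Type*} [∀ n, MeasurableSpace (Ω n)] {P : (n : ℕ+) → Measure (Ω n)}
  [∀ n, IsProbabilityMeasure (P n)]
  {draw : (n : ℕ+) → ℕ → Ω n → Fin n} {d : ℕ} {k : ℕ+ → ℕ}

lemma tendsto_gumbel_atTop (d : ℕ) :
    Tendsto (fun x : ℝ => Real.exp (-(Real.exp (-x) / d.factorial))) atTop (𝓝 1) := by
  refine tendsto_exp_one_of_tendsto_zero ?_
  simpa using ((Real.tendsto_exp_neg_atTop_nhds_zero).div_const (d.factorial : ℝ)).neg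

lemma tendsto_gumbel_atBot (d : ℕ) :
    Tendsto (fun x : ℝ => Real.exp (-(Real.exp (-x) / d.factorial))) atBot (𝓝 0) := by
  have h1 : Tendsto (fun x : ℝ => Real.exp (-x) / d.factorial) atBot atTop :=
    (Real.tendsto_exp_atTop.comp tendsto_neg_atBot_atTop).atTop_div_const (by positivity)
  exact Real.tendsto_exp_neg_atTop_nhds_zero.comp h1

/-- The collection is completed with probability tending to one. -/
lemma tendsto_measureReal_never_complete (hdraw : ∀ n, IsCouponSequence (P n) (draw n)) (d : ℕ) :
    Tendsto (fun n => (P n).real {ω | ∃ t, ∀ c, d + 1 ≤ copies (fun i => draw n i ω) t c}ᶜ) atTop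
      (𝓝 0) := by
  rw [Metric.tendsto_nhds]
  intro ε hε
  obtain ⟨y, hy⟩ := ((tendsto_gumbel_atTop d).eventually_const_lt
    (by linarith : 1 - ε < 1)).exists
  have h1 := tendsto_measureReal_forall_le_copies hdraw (isCollectionScale_collectionFloor d y)
  filter_upwards [h1.eventually_const_lt hy] with n hn
  rw [Real.dist_eq, sub_zero, abs_of_nonneg measureReal_nonneg,
    probReal_compl_eq_one_sub ((hdraw n).measurableSet_exists_forall_le_copies (d + 1))]
  have : (P n).real {ω | ∀ c, d + 1 ≤ copies (fun i => draw n i ω) (collectionFloor d y n) c} ≤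
      (P n).real {ω | ∃ t, ∀ c, d + 1 ≤ copies (fun i => draw n i ω) t c} :=
    measureReal_mono fun ω hω => ⟨_, hω⟩
  linarith

lemma tendsto_measureReal_centredTime_le (hdraw : ∀ n, IsCouponSequence (P n) (draw n)) (d : ℕ)
    (x : ℝ) :
    Tendsto (fun n => (P n).real {ω | centredTime d n (collectionTime (d + 1) fun i => draw n i ω) ≤ x})
      atTop (𝓝 (Real.exp (-(Real.exp (-x) / d.factorial)))) := by
  have h1 := tendsto_measureReal_forall_le_copies hdraw (isCollectionScale_collectionFloor d x)
  have h2 := h1.add (tendsto_measureReal_never_complete hdraw d)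
  rw [add_zero] at h2
  refine tendsto_of_tendsto_of_tendsto_of_le_of_le' h1 h2 ?_ ?_
  · filter_upwards [eventually_collectionFloor_arg_nonneg d x] with n hn
    refine measureReal_mono fun ω hω => ?_
    exact (centredTime_le_iff hn).2 (collectionTime_le hω)
  · filter_upwards [eventually_collectionFloor_arg_nonneg d x] with n hn
    refine (measureReal_mono fun ω hω => ?_).trans (measureReal_union_le _ _)
    by_cases hc : ∃ t, ∀ c, d + 1 ≤ copies (fun i => draw n i ω) t c
    · exact Or.inl ((collectionTime_le_iff hc).1 ((centredTime_le_iff hn).1 hω))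
    · exact Or.inr hc

lemma exists_crossing {p : ℕ → Prop} {M : ℕ} (h0 : ¬ p 0) (hM : p M) :
    ∃ i < M, ¬ p i ∧ p (i + 1) := by
  by_contra! h
  have : ∀ i ≤ M, ¬ p i := by
    intro i
    induction i with
    | zero => exact fun _ => h0
    | succ i ih => exact fun hi => h i (by omega) (ih (by omega))
  exact this M le_rfl hM

/-- The scaled number of `k`-tons at the completion time is close to `exp (-Y)`, where `Y` is the
centred completion time. -/
lemma tendsto_measureReal_numTons_sub (hdraw : ∀ n, IsCouponSequence (P n) (draw n))
    (hk : IsTonSequence d k) {ε : ℝ} (hε : 0 < ε) :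
    Tendsto (fun n => (P n).real {ω | ε ≤ |tonScale d k n *
      (numTons (d + 1) (k n) fun i => draw n i ω) -
        Real.exp (-centredTime d n (collectionTime (d + 1) fun i => draw n i ω))|}) atTop (𝓝 0) := by
  rw [Metric.tendsto_nhds]
  intro η hη
  -- Outside `(-A, A]` the Gumbel limit leaves mass less than `η / 4` in each tail.
  obtain ⟨A, hA1, hA2⟩ : ∃ A : ℝ, 1 - η / 4 < Real.exp (-(Real.exp (-A) / d.factorial)) ∧
      Real.exp (-(Real.exp (-(-A)) / d.factorial)) < η / 4 :=
    (((tendsto_gumbel_atTop d).eventually_const_lt (by linarith : 1 - η / 4 < 1)).and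
      (((tendsto_gumbel_atBot d).comp tendsto_neg_atTop_atBot).eventually_lt_const
        (by positivity : 0 < η / 4))).exists
  -- On `[-A, ∞)` the slope of `exp (-·)` is at most `exp A` in size, so across one cell of this
  -- mesh it varies by at most `ε / 2`.
  set h : ℝ := ε / 2 * Real.exp (-A) with hh
  have hpos : 0 < h := by positivity
  obtain ⟨M, hM⟩ := exists_nat_ge (2 * A / h)
  rw [div_le_iff₀ hpos] at hM
  let g : ℕ → ℝ := fun i => -A + i * h
  have hgap : ∀ i, Real.exp (-g i) - Real.exp (-g (i + 1)) ≤ ε / 2 := by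
    intro i
    have e1 : -g (i + 1) = -g i + -h := by simp only [g]; push_cast; ring
    have e2 : Real.exp (-g i) ≤ Real.exp A := by
      refine Real.exp_le_exp.2 ?_
      have : 0 ≤ (i : ℝ) * h := by positivity
      simp only [g]; linarith
    have e3 : 1 - Real.exp (-h) ≤ h := by linarith [Real.add_one_le_exp (-h)]
    rw [e1, Real.exp_add]
    calc Real.exp (-g i) - Real.exp (-g i) * Real.exp (-h)
        = Real.exp (-g i) * (1 - Real.exp (-h)) := by ring
      _ ≤ Real.exp (-g i) * h := by gcongr
      _ ≤ Real.exp A * h := by gcongr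
      _ = ε / 2 * (Real.exp A * Real.exp (-A)) := by rw [hh]; ring
      _ = ε / 2 := by rw [← Real.exp_add, add_neg_cancel, Real.exp_zero, mul_one]
  let D : ℕ → (n : ℕ+) → Set (Ω n) := fun i n =>
    {ω | ∀ c, d + 1 ≤ copies (fun i => draw n i ω) (collectionFloor d (g i) n) c}
  let B : ℕ → (n : ℕ+) → Set (Ω n) := fun i n =>
    {ω | ε / 4 ≤ |tonScale d k n * ((Finset.univ.filter fun c =>
      copies (fun i => draw n i ω) (collectionFloor d (g i) n) c = k n).card : ℝ) -
        Real.exp (-g i)|} ∪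
    {ω | ε / 4 ≤ tonScale d k n * ((Finset.univ.filter fun c =>
      copies (fun i => draw n i ω) (collectionFloor d (g i) n) c < k n).card : ℝ)}
  have hB : ∀ i, Tendsto (fun n => (P n).real (B i n)) atTop (𝓝 0) := by
    intro i
    have hs := isCollectionScale_collectionFloor d (g i)
    have h1 := (tendsto_measureReal_tons_sub hdraw hk hs (by positivity : 0 < ε / 4)).add
      (tendsto_measureReal_lt_tons hdraw hk hs (by positivity : 0 < ε / 4))
    rw [add_zero] at h1
    exact squeeze_zero (fun _ => measureReal_nonneg) (fun n => measureReal_union_le _ _) h1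
  have hBsum : Tendsto (fun n => ∑ i ∈ Finset.range (M + 1), (P n).real (B i n)) atTop (𝓝 0) := by
    simpa using tendsto_finsetSum (Finset.range (M + 1)) fun i _ => hB i
  have hD := fun i => tendsto_measureReal_forall_le_copies hdraw
    (isCollectionScale_collectionFloor d (g i))
  have hg0 : g 0 = -A := by simp [g]
  have hgM : A ≤ g M := by simp only [g]; linarith
  have hlimM : 1 - η / 4 < Real.exp (-(Real.exp (-g M) / d.factorial)) := by
    refine hA1.trans_le ?_
    gcongr
  have hlim0 : Real.exp (-(Real.exp (-g 0) / d.factorial)) < η / 4 := by rw [hg0]; exact hA2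
  have hfloor : ∀ᶠ n : ℕ+ in atTop, ∀ i ∈ Finset.range (M + 1),
      0 ≤ (n : ℝ) * (Real.log n + d * Real.log (Real.log n) + g i) :=
    (Finset.eventually_all _).2 fun i _ => eventually_collectionFloor_arg_nonneg d (g i)
  filter_upwards [hBsum.eventually_lt_const (by positivity : 0 < η / 4), hfloor,
    (hD 0).eventually_lt_const hlim0, (hD M).eventually_const_lt hlimM,
    tendsto_log_pnat.eventually_gt_atTop 0] with n hn1 hn2 hn3 hn4 hn5
  rw [Real.dist_eq, sub_zero, abs_of_nonneg measureReal_nonneg]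
  have ha : 0 ≤ tonScale d k n := by unfold tonScale; positivity
  have hsub : {ω | ε ≤ |tonScale d k n * (numTons (d + 1) (k n) fun i => draw n i ω) -
      Real.exp (-centredTime d n (collectionTime (d + 1) fun i => draw n i ω))|} ⊆
      (D 0 n ∪ (D M n)ᶜ) ∪ ⋃ i ∈ Finset.range (M + 1), B i n := by
    intro ω hω
    by_contra hcon
    simp only [Set.mem_union, Set.mem_compl_iff, not_or, not_not, Set.mem_iUnion, exists_prop,
      not_exists, not_and] at hcon
    obtain ⟨⟨h0, hM'⟩, hgood⟩ := hcon
    -- The collection is incomplete at the first grid time and complete at the last, so some cell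
    -- `(g i, g (i + 1)]` contains the centred time.
    obtain ⟨i, hiM, hi0, hi1⟩ := exists_crossing (p := fun i => ω ∈ D i n) h0 hM'
    set x : ℕ → Fin n := fun i => draw n i ω with hx
    have hgi := hgood i (Finset.mem_range.2 (by omega))
    have hgi1 := hgood (i + 1) (Finset.mem_range.2 (by omega))
    simp only [B, Set.mem_union, Set.mem_ofPred_eq, not_or, not_le] at hgi hgi1
    have hT1 : collectionTime (d + 1) x ≤ collectionFloor d (g (i + 1)) n := collectionTime_le hi1
    have hT0 : ¬ collectionTime (d + 1) x ≤ collectionFloor d (g i) n := fun hle =>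
      hi0 ((collectionTime_le_iff ⟨_, hi1⟩).1 hle)
    have hY1 : centredTime d n (collectionTime (d + 1) x) ≤ g (i + 1) :=
      (centredTime_le_iff (hn2 (i + 1) (Finset.mem_range.2 (by omega)))).2 hT1
    have hY0 : g i < centredTime d n (collectionTime (d + 1) x) :=
      not_le.1 fun hle => hT0 ((centredTime_le_iff (hn2 i (Finset.mem_range.2 (by omega)))).1 hle)
    have hE1 : Real.exp (-g (i + 1)) ≤ Real.exp (-centredTime d n (collectionTime (d + 1) x)) :=
      Real.exp_le_exp.2 (neg_le_neg hY1)
    have hE0 : Real.exp (-centredTime d n (collectionTime (d + 1) x)) ≤ Real.exp (-g i) :=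
      Real.exp_le_exp.2 (neg_le_neg hY0.le)
    -- Compare `T` with the grid time before it, then the grid time after it with `T`. In both cases
    -- the surplus is at most the number of types below `k` at the earlier grid time. The errors add
    -- up to `ε/4 + ε/4 + ε/2`.
    have hup := card_copies_eq_le (x := x) (k := k n) (not_le.1 hT0).le
    have hlow := (card_copies_eq_le (x := x) (k := k n) hT1).trans
      (Nat.add_le_add_left (card_copies_lt_anti (not_le.1 hT0).le) _)
    have hup' := mul_le_mul_of_nonneg_left (Nat.cast_le (α := ℝ).2 hup) ha
    have hlow' := mul_le_mul_of_nonneg_left (Nat.cast_le (α := ℝ).2 hlow) ha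
    push_cast at hup' hlow'
    rw [mul_add] at hup' hlow'
    have hω' : ε ≤ |tonScale d k n * ((Finset.univ.filter fun c =>
      copies x (collectionTime (d + 1) x) c = k n).card : ℝ) -
      Real.exp (-centredTime d n (collectionTime (d + 1) x))| := hω
    have hgap' := hgap i
    obtain ⟨ha1, ha2⟩ := abs_lt.1 hgi.1
    obtain ⟨ha3, ha4⟩ := abs_lt.1 hgi1.1
    have ha5 := hgi.2
    refine absurd hω' (not_le.2 (abs_lt.2 ⟨?_, ?_⟩)) <;> linarith
  have hDM : MeasurableSet (D M n) :=
    (hdraw n).measurableSet_copies' _ fun v => ∀ c, d + 1 ≤ v c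
  have hDMc : (P n).real (D M n)ᶜ = 1 - (P n).real (D M n) := probReal_compl_eq_one_sub hDM
  calc _ ≤ (P n).real ((D 0 n ∪ (D M n)ᶜ) ∪ ⋃ i ∈ Finset.range (M + 1), B i n) :=
        measureReal_mono hsub
    _ ≤ ((P n).real (D 0 n) + (P n).real (D M n)ᶜ) + ∑ i ∈ Finset.range (M + 1), (P n).real (B i n) :=
        (measureReal_union_le _ _).trans (add_le_add (measureReal_union_le _ _)
          (measureReal_biUnion_finset_le _ _))
    _ < η := by
        rw [hDMc]
        have h3 : (P n).real (D 0 n) < η / 4 := hn3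
        have h4 : 1 - η / 4 < (P n).real (D M n) := hn4
        linarith

end Family

/-- For `d = 0` the `log log` condition is void thanks to its factor `d`. For `d ≥ 1` the stronger
hypothesis implies `k = o(log n)`, since eventually `log log n ≥ 1`. -/
lemma isTonSequence_of_isLittleO {d : ℕ} {k : ℕ+ → ℕ} (hmk : ∀ᶠ n in atTop, d + 1 ≤ k n)
    (hk_one : d + 1 = 1 → (fun n => (k n : ℝ)) =o[atTop] fun n : ℕ+ => Real.log n)
    (hk_two : 2 ≤ d + 1 →
      (fun n => (k n : ℝ)) =o[atTop] fun n : ℕ+ => Real.log n / Real.log (Real.log n)) :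
    IsTonSequence d k := by
  rcases Nat.eq_zero_or_pos d with rfl | hd
  · exact ⟨hmk, (hk_one rfl).tendsto_div_nhds_zero, by simp⟩
  · have h1 := (hk_two (by omega)).tendsto_div_nhds_zero
    have h2 := Real.tendsto_log_atTop.comp tendsto_log_pnat
    have h3 : Tendsto (fun n : ℕ+ => (k n : ℝ) * Real.log (Real.log n) / Real.log n) atTop (𝓝 0) := by
      refine h1.congr fun n => ?_
      rw [div_div_eq_mul_div]
    refine ⟨hmk, ?_, ?_⟩
    · refine squeeze_zero' ?_ ?_ h3
      · filter_upwards [tendsto_log_pnat.eventually_gt_atTop 0] with n hn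
        positivity
      · filter_upwards [tendsto_log_pnat.eventually_gt_atTop 0, h2.eventually_ge_atTop 1] with n hn hl
        simp only [Function.comp] at hl
        gcongr
        exact le_mul_of_one_le_right (Nat.cast_nonneg _) hl
    · have := h3.const_mul (d : ℝ)
      rw [mul_zero] at this
      refine this.congr fun n => ?_
      ring

theorem theorem1 (m : ℕ) (hm : 1 ≤ m)
    {Ω : ℕ+ → Type*} [∀ n, MeasurableSpace (Ω n)]
    (P : (n : ℕ+) → Measure (Ω n)) [∀ n, IsProbabilityMeasure (P n)]
    (draw : (n : ℕ+) → ℕ → Ω n → Fin n) (hdraw : ∀ n, IsCouponSequence (P n) (draw n))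
    (k : ℕ+ → ℕ) (hmk : ∀ᶠ n in atTop, m ≤ k n)
    (hk_one : m = 1 →
      (fun n => (k n : ℝ)) =o[atTop] fun n : ℕ+ => Real.log n)
    (hk_two : 2 ≤ m →
      (fun n => (k n : ℝ)) =o[atTop] fun n : ℕ+ => Real.log n / Real.log (Real.log n))
    {Ω' : Type*} [MeasurableSpace Ω'] (P' : Measure Ω') [IsProbabilityMeasure P']
    (X : Ω' → ℝ) (hX : IsGumbel P' X (-Real.log ((m - 1).factorial : ℝ)) 1) :
    TendstoInDistribution
      (fun (n : ℕ+) (ω : Ω n) =>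
        ((((collectionTime m (fun i => draw n i ω) : ℕ) : ℝ) - (n : ℝ) * Real.log n
            - ((m : ℝ) - 1) * (n : ℝ) * Real.log (Real.log n)) / (n : ℝ),
          ((k n).factorial : ℝ) * ((numTons m (k n) (fun i => draw n i ω) : ℕ) : ℝ)
            / Real.log n ^ (k n - m + 1)))
      atTop
      (fun ω' => (X ω', Real.exp (-X ω')))
      P P' := by
  obtain ⟨d, rfl⟩ : ∃ d, m = d + 1 := ⟨m - 1, by omega⟩
  have hk := isTonSequence_of_isLittleO hmk hk_one hk_two
  obtain ⟨hXm, hXcdf⟩ := hX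
  let Y : (n : ℕ+) → Ω n → ℝ := fun n ω =>
    centredTime d n (collectionTime (d + 1) fun i => draw n i ω)
  let Z : (n : ℕ+) → Ω n → ℝ := fun n ω =>
    tonScale d k n * (numTons (d + 1) (k n) fun i => draw n i ω)
  have hY : ∀ n, Measurable (Y n) := fun n =>
    (measurable_of_countable (centredTime d n)).comp ((hdraw n).measurable_collectionTime (d + 1))
  have hZ : ∀ n, Measurable (Z n) := fun n =>
    (measurable_of_countable fun s : ℕ => tonScale d k n * (s : ℝ)).comp
      ((hdraw n).measurable_numTons (d + 1) (k n))
  have hYX : TendstoInDistribution Y atTop X P P' := by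
    refine tendstoInDistribution_of_tendsto_measureReal_le (fun n => (hY n).aemeasurable) hXm
      fun x => ?_
    have h1 := tendsto_measureReal_centredTime_le hdraw d x
    -- The location `-log d!` turns into the factor `1 / d!` in front of `exp (-x)`.
    have h2 : P'.real {ω | X ω ≤ x} = Real.exp (-(Real.exp (-x) / d.factorial)) := by
      rw [hXcdf, div_one, sub_neg_eq_add, neg_add, Real.exp_add, Real.exp_neg (Real.log _),
        Real.exp_log (by positivity), Nat.add_sub_cancel]
      rfl
    rw [h2]
    exact h1
  -- The pair `(Y, exp (-Y))` converges by continuous mapping; replacing `exp (-Y)` by `Z` changes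
  -- only the second coordinate, by an error vanishing in probability.
  have hpair := hYX.continuous_comp (g := fun y : ℝ => (y, Real.exp (-y))) (by fun_prop)
  have hYZ : TendstoInDistribution (fun n ω => (Y n ω, Z n ω)) atTop
      (fun ω' => (X ω', Real.exp (-X ω'))) P P' := by
    refine tendstoInDistribution_of_tendsto_measureReal_sub hpair (fun ε hε => ?_)
      fun n => ((hY n).prodMk (hZ n)).aemeasurable
    refine (tendsto_measureReal_numTons_sub hdraw hk hε).congr fun n => ?_
    congr 1
    ext ω
    simp [Y, Z, Prod.norm_def]
  have heq : (fun (n : ℕ+) (ω : Ω n) =>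
        ((((collectionTime (d + 1) (fun i => draw n i ω) : ℕ) : ℝ) - (n : ℝ) * Real.log n
            - (((d + 1 : ℕ) : ℝ) - 1) * (n : ℝ) * Real.log (Real.log n)) / (n : ℝ),
          ((k n).factorial : ℝ) * ((numTons (d + 1) (k n) (fun i => draw n i ω) : ℕ) : ℝ)
            / Real.log n ^ (k n - (d + 1) + 1))) = fun n ω => (Y n ω, Z n ω) := by
    funext n ω
    simp only [Y, Z, centredTime, tonScale, Prod.mk.injEq, true_and]
    ring
  rw [heq]
  exact hYZ
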